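/- Let $S$ be a Noetherian local ring with maximal ideal $\mathfrak m$, let $f_1,\dots,f_c$ be a regular sequence in $S$, and put $R(p)=S/(f_1,\dots,f_p)$ for $0\le p\le c$ and $R=R(c)$. All modules are finitely generated. **Syzygies.** Let $({\bf F},\delta)$ be a complex of free $R$-modules with $F_i=0$ for $i<0$. Lift it to free $S$-modules $\widetilde F_i$ and maps $\widetilde\delta_i$ with $R\otimes\widetilde\delta=\delta$, and choose maps $\widetilde t_j:\widetilde F_{i+2}\to\widetilde F_i$ with $\widetilde\delta^2=\sum_j f_j\widetilde t_j$. The maps $t_j=R\otimes\widetilde t_j$ are called CI operators on ${\bf F}$. An $R$-module $M$ is a *pre-stable syzygy* with respect to $f_1,\dots,f_c$ if either $c=0$ and $M=0$, or $c\ge1$ and there is a minimal $R$-free resolution $({\bf F},\delta)$ of an $R$-module $L$ of finite projective dimension over $S$ such that $M\cong{\rm Ker}(\delta_1:F_1\to F_0)$, there is a surjective CI operator $t_c$ on ${\bf F}$, and for every lifting $\widetilde\delta_1$ of $\delta_1$ to $R(c-1)$ the module ${\rm Ker}(\widetilde\delta_1)$ is a pre-stable syzygy with respect to $f_1,\dots,f_{c-1}$.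 It is a *stable syzygy* if either $c=0$ and $M=0$, or $c\geq 1$ and ${\bf F}$ can be chosen so that, in addition, $L$ is a maximal Cohen-Macaulay $R$-module and each ${\rm Ker}(\widetilde\delta_1)$ is a stable syzygy with respect to $f_1,\dots,f_{c-1}$. (The zero module counts as maximal Cohen-Macaulay.) **Higher matrix factorizations.** A *higher matrix factorization* $(d,h)$ with respect to $f_1,\dots,f_c$ consists of finitely generated free $S$-modules $A_0,A_1$ with filtrations $0=A_s(0)\subseteq A_s(1)\subseteq\dots\subseteq A_s(c)=A_s$, each $A_s(p-1)$ being a free summand of $A_s(p)$, and filtration preserving maps $\bigoplus_{q=1}^cA_0(q)\xrightarrow{h}A_1\xrightarrow{d}A_0$, with induced maps $A_0(p)\xrightarrow{h_p}A_1(p)\xrightarrow{d_p}A_0(p)$, such that for $1\le p\le c$, with $B_1(p)=A_1(p)/A_1(p-1)$ and $\pi_p:A_1(p)\to B_1(p)$ the projection, $$d_ph_p\equiv f_p\,{\rm Id}\ \bmod (f_1,\dots,f_{p-1})A_0(p),\qquad \pi_ph_pd_p\equiv f_p\pi_p\ \bmod (f_1,\dots,f_{p-1})B_1(p).$$ Its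 module is ${\rm Coker}(R\otimes d)$. It is *minimal* if $d(A_1)\subseteq\mathfrak mA_0$ and the image of $h$ lies in $\mathfrak mA_1$. For $1\le p\le c$ let $C_p$ be the cokernel of the composite $$R(p-1)\otimes A_0(p-1)\hookrightarrow R(p-1)\otimes A_0(p)\xrightarrow{h_p}R(p-1)\otimes A_1(p)\xrightarrow{\pi_p}R(p-1)\otimes B_1(p).$$ The higher matrix factorization is *pre-stable* if $f_p$ is a non-zerodivisor on $C_p$ for every $p$, and *stable* if $C_p$ is a maximal Cohen-Macaulay $R(p-1)$-module for every $p$. **Theorem.** If $M$ is a pre-stable syzygy over $R$ with respect to $f_1,\dots,f_c$, then there is a minimal pre-stable higher matrix factorization $(d,h)$ with respect to $f_1,\dots,f_c$ whose module is isomorphic to $M$ and such that $d$ and $h$ are liftings to $S$ of the first two differentials of the minimal $R$-free resolution of $M$, that is, $R\otimes d$ and $R\otimes h$ are, up to isomorphisms of the free modules, these differentials. If $M$ is a stable syzygy, then $(d,h)$ can be chosen so that it is stable as well. -/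

import Mathlib

open scoped TensorProduct

universe u

/-! ### Maximal Cohen-Macaulay modules -/

/-- For a Noetherian local ring `R`: the finitely generated `R`-module `M` is maximal Cohen-Macaulay,
i.e. `depth M ≥ dim R`; the zero module (of depth `∞`) is included. For `M ≠ 0` this says that there
is an `M`-regular sequence of length `dim R`. (The requirement `(rs) M ≠ M` in
`RingTheory.Sequence.IsRegular` forces the members of the sequence to be non-units, that is, to lie
in the maximal ideal.) -/
def IsMaximalCohenMacaulay (R : Type*) [CommRing R] (M : Type*) [AddCommGroup M] [Module R M] :
    Prop :=
  Module.Finite R M ∧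
    (Subsingleton M ∨ ∃ rs : List R, RingTheory.Sequence.IsRegular M rs ∧
      ((rs.length : ℕ∞) : WithBot ℕ∞) = ringKrullDim R)

/-! ### Minimal free resolutions over a quotient of a local ring, and CI operators -/

/-- A minimal free resolution `⋯ → F₂ → F₁ → F₀` over `R = S ⧸ I` by finitely generated free
modules `F i = R ^ (rank i)`, where `S` is local and `I` is a proper ideal. The matrix `δ i`
represents the differential `F (i + 1) → F i`. -/
structure MinimalFreeResolution {S : Type u} [CommRing S] [IsLocalRing S] (I : Ideal S) where
  rank : ℕ → ℕ
  δ : ∀ i, Matrix (Fin (rank i)) (Fin (rank (i + 1))) (S ⧸ I)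
  exact : ∀ i, Function.Exact (δ (i + 1)).mulVecLin (δ i).mulVecLin
  /-- The entries lie in the maximal ideal of `S ⧸ I`. -/
  minimal : ∀ i k l, δ i k l ∈ (IsLocalRing.maximalIdeal S).map (Ideal.Quotient.mk I)

namespace MinimalFreeResolution

variable {S : Type u} [CommRing S] [IsLocalRing S] {I : Ideal S}

/-- The module resolved by `F`, namely the cokernel of `F₁ → F₀`. -/
abbrev resolved (F : MinimalFreeResolution I) : Type u :=
  (Fin (F.rank 0) → S ⧸ I) ⧸ LinearMap.range (F.δ 0).mulVecLin

/-- The second syzygy `Ker (F₁ → F₀)`. -/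
abbrev kerFirst (F : MinimalFreeResolution I) : Submodule (S ⧸ I) (Fin (F.rank 1) → S ⧸ I) :=
  LinearMap.ker (F.δ 0).mulVecLin

/-- The module resolved by `F` has finite projective dimension over `S`. -/
def FiniteProjDimOverBase (F : MinimalFreeResolution I) : Prop :=
  ∃ n : ℕ, CategoryTheory.HasProjectiveDimensionLE (ModuleCat.of S F.resolved) n

end MinimalFreeResolution

/-- The ideal generated by all members of the sequence `f`. -/
abbrev seqIdeal {S : Type u} [CommRing S] {c : ℕ} (f : Fin c → S) : Ideal S :=
  Ideal.span (Set.range f)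

/-- The ideal `(f₁, …, f_{p-1})` generated by the members of the sequence that precede the `p`-th. -/
abbrev prevIdeal {S : Type u} [CommRing S] {c : ℕ} (f : Fin c → S) (p : Fin c) : Ideal S :=
  Ideal.span (f '' {j | j < p})

/-- The sequence with its last member dropped. -/
abbrev dropLast {S : Type u} {c : ℕ} (f : Fin (c + 1) → S) : Fin c → S :=
  fun i => f i.castSucc

theorem seqIdeal_dropLast_le {S : Type u} [CommRing S] {c : ℕ} (f : Fin (c + 1) → S) :
    seqIdeal (dropLast f) ≤ seqIdeal f := by
  apply Ideal.span_mono
  rintro _ ⟨i, rfl⟩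
  exact ⟨i.castSucc, rfl⟩

/-- A lifting `δ'` to `S` of the differential of `F`, together with maps `t' j` such that
`δ' ∘ δ' = ∑ j, f j • t' j`. -/
structure CIOperators {S : Type u} [CommRing S] [IsLocalRing S] {c : ℕ} (f : Fin c → S)
    (F : MinimalFreeResolution (seqIdeal f)) where
  δ' : ∀ i, Matrix (Fin (F.rank i)) (Fin (F.rank (i + 1))) S
  lifts : ∀ i, (δ' i).map (Ideal.Quotient.mk (seqIdeal f)) = F.δ i
  t' : Fin c → ∀ i, Matrix (Fin (F.rank i)) (Fin (F.rank (i + 2))) S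
  sq : ∀ i, δ' i * δ' (i + 1) = ∑ j, f j • t' j i

namespace CIOperators

variable {S : Type u} [CommRing S] [IsLocalRing S] {c : ℕ} {f : Fin c → S}
  {F : MinimalFreeResolution (seqIdeal f)}

/-- The CI operator `t_j = R ⊗ t'_j : F (i + 2) → F i`. -/
def t (T : CIOperators f F) (j : Fin c) (i : ℕ) :
    Matrix (Fin (F.rank i)) (Fin (F.rank (i + 2))) (S ⧸ seqIdeal f) :=
  (T.t' j i).map (Ideal.Quotient.mk (seqIdeal f))

end CIOperators

/-- The last CI operator on `F` can be chosen surjective. -/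
def HasSurjectiveLastCIOperator {S : Type u} [CommRing S] [IsLocalRing S] {c : ℕ}
    (f : Fin (c + 1) → S) (F : MinimalFreeResolution (seqIdeal f)) : Prop :=
  ∃ T : CIOperators f F, ∀ i, Function.Surjective (T.t (Fin.last c) i).mulVecLin

/-- The matrix `δ₁'` over `S ⧸ (f₁, …, f_{c-1})` is a lifting of the first differential of `F`. -/
def IsLiftOfFirst {S : Type u} [CommRing S] [IsLocalRing S] {c : ℕ}
    (f : Fin (c + 1) → S) (F : MinimalFreeResolution (seqIdeal f))
    (δ₁' : Matrix (Fin (F.rank 0)) (Fin (F.rank 1)) (S ⧸ seqIdeal (dropLast f))) : Prop :=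
  δ₁'.map (Ideal.Quotient.factor (seqIdeal_dropLast_le f)) = F.δ 0

/-! ### Pre-stable and stable syzygies -/

/-- `M` is a pre-stable syzygy with respect to `f₁, …, f_c`. -/
def IsPreStableSyzygy {S : Type u} [CommRing S] [IsLocalRing S] :
    (c : ℕ) → (f : Fin c → S) → (M : Type u) → [AddCommGroup M] → [Module (S ⧸ seqIdeal f) M] → Prop
  | 0, _, M, _, _ => Subsingleton M
  | c + 1, f, M, _, _ =>
    ∃ F : MinimalFreeResolution (seqIdeal f),
      F.FiniteProjDimOverBase ∧ HasSurjectiveLastCIOperator f F ∧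
      Nonempty (M ≃ₗ[S ⧸ seqIdeal f] F.kerFirst) ∧
      ∀ δ₁' : Matrix (Fin (F.rank 0)) (Fin (F.rank 1)) (S ⧸ seqIdeal (dropLast f)),
        IsLiftOfFirst f F δ₁' →
          IsPreStableSyzygy c (dropLast f) (LinearMap.ker δ₁'.mulVecLin)

/-- `M` is a stable syzygy with respect to `f₁, …, f_c`: as for pre-stable syzygies, where moreover
at each stage the module resolved by `F` is maximal Cohen-Macaulay. -/
def IsStableSyzygy {S : Type u} [CommRing S] [IsLocalRing S] :
    (c : ℕ) → (f : Fin c → S) → (M : Type u) → [AddCommGroup M] → [Module (S ⧸ seqIdeal f) M] → Prop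
  | 0, _, M, _, _ => Subsingleton M
  | c + 1, f, M, _, _ =>
    ∃ F : MinimalFreeResolution (seqIdeal f),
      F.FiniteProjDimOverBase ∧ HasSurjectiveLastCIOperator f F ∧
      Nonempty (M ≃ₗ[S ⧸ seqIdeal f] F.kerFirst) ∧
      IsMaximalCohenMacaulay (S ⧸ seqIdeal f) F.resolved ∧
      ∀ δ₁' : Matrix (Fin (F.rank 0)) (Fin (F.rank 1)) (S ⧸ seqIdeal (dropLast f)),
        IsLiftOfFirst f F δ₁' →
          IsStableSyzygy c (dropLast f) (LinearMap.ker δ₁'.mulVecLin)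

/-! ### Higher matrix factorizations -/

/-- A finitely generated free `S`-module `A` with a filtration
`0 = A(0) ⊆ A(1) ⊆ ⋯ ⊆ A(c) = A` such that each `A(p-1)` is a free summand of `A(p)`. -/
structure FilteredFreeModule (S : Type u) [CommRing S] (c : ℕ) where
  carrier : Type u
  [addCommGroup : AddCommGroup carrier]
  [module : Module S carrier]
  [finite : Module.Finite S carrier]
  fil : Fin (c + 1) → Submodule S carrier
  fil_zero : fil 0 = ⊥
  fil_last : fil (Fin.last c) = ⊤
  free : ∀ p, Module.Free S (fil p)
  summand : ∀ p : Fin c, ∃ N : Submodule S carrier,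
    Disjoint (fil p.castSucc) N ∧ fil p.castSucc ⊔ N = fil p.succ

attribute [instance] FilteredFreeModule.addCommGroup FilteredFreeModule.module
  FilteredFreeModule.finite

namespace FilteredFreeModule

variable {S : Type u} [CommRing S] {c : ℕ}

theorem fil_le (A : FilteredFreeModule S c) (p : Fin c) : A.fil p.castSucc ≤ A.fil p.succ := by
  obtain ⟨N, -, h⟩ := A.summand p
  exact h ▸ le_sup_left

/-- The quotient `B(p) = A(p) / A(p-1)`. (The index `p : Fin c`, counted from `0`, stands for the
number `p + 1` in `1, …, c`; so `p.succ` and `p.castSucc` are the steps `A(p)` and `A(p-1)`.) -/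
abbrev B (A : FilteredFreeModule S c) (p : Fin c) : Type u :=
  A.fil p.succ ⧸ (A.fil p.castSucc).submoduleOf (A.fil p.succ)

/-- The projection `π_p : A(p) → B(p)`. -/
abbrev π (A : FilteredFreeModule S c) (p : Fin c) : A.fil p.succ →ₗ[S] A.B p :=
  Submodule.mkQ _

/-- The inclusion `A(p-1) ↪ A(p)`. -/
abbrev incl (A : FilteredFreeModule S c) (p : Fin c) : A.fil p.castSucc →ₗ[S] A.fil p.succ :=
  Submodule.inclusion (A.fil_le p)

end FilteredFreeModule

/-- A higher matrix factorization `(d, h)` with respect to `f₁, …, f_c`. The filtration preserving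
map `h : ⨁_q A₀(q) → A₁` is given by its components `h_p : A₀(p) → A₁(p)`. -/
structure HigherMatrixFactorization {S : Type u} [CommRing S] {c : ℕ} (f : Fin c → S) where
  A₀ : FilteredFreeModule S c
  A₁ : FilteredFreeModule S c
  d : A₁.carrier →ₗ[S] A₀.carrier
  d_fil : ∀ p, ∀ x ∈ A₁.fil p, d x ∈ A₀.fil p
  h : ∀ p : Fin c, A₀.fil p.succ →ₗ[S] A₁.fil p.succ
  /-- `d_p h_p ≡ f_p Id` modulo `(f₁, …, f_{p-1}) A₀(p)`. -/
  d_h : ∀ (p : Fin c) (x : A₀.fil p.succ),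
    d.restrict (d_fil p.succ) (h p x) - f p • x ∈
      prevIdeal f p • (⊤ : Submodule S (A₀.fil p.succ))
  /-- `π_p h_p d_p ≡ f_p π_p` modulo `(f₁, …, f_{p-1}) (A₁(p) / A₁(p-1))`. -/
  h_d : ∀ (p : Fin c) (x : A₁.fil p.succ),
    A₁.π p (h p (d.restrict (d_fil p.succ) x)) - f p • A₁.π p x ∈
      prevIdeal f p • (⊤ : Submodule S (A₁.B p))

namespace HigherMatrixFactorization

variable {S : Type u} [CommRing S] {c : ℕ} {f : Fin c → S}

/-- The source `⨁_q A₀(q)` of `h`. -/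
abbrev hSource (X : HigherMatrixFactorization f) : Type u :=
  ∀ p : Fin c, X.A₀.fil p.succ

/-- The map `h = (h₁ | ⋯ | h_c) : ⨁_q A₀(q) → A₁`. -/
def hTotal (X : HigherMatrixFactorization f) : X.hSource →ₗ[S] X.A₁.carrier :=
  ∑ p : Fin c, (X.A₁.fil p.succ).subtype ∘ₗ X.h p ∘ₗ LinearMap.proj p

/-- `R ⊗ d`, where `R = S / (f₁, …, f_c)`. -/
abbrev dBar (X : HigherMatrixFactorization f) :
    (S ⧸ seqIdeal f) ⊗[S] X.A₁.carrier →ₗ[S ⧸ seqIdeal f] (S ⧸ seqIdeal f) ⊗[S] X.A₀.carrier :=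
  X.d.baseChange (S ⧸ seqIdeal f)

/-- `R ⊗ h`, where `R = S / (f₁, …, f_c)`. -/
abbrev hBar (X : HigherMatrixFactorization f) :
    (S ⧸ seqIdeal f) ⊗[S] X.hSource →ₗ[S ⧸ seqIdeal f] (S ⧸ seqIdeal f) ⊗[S] X.A₁.carrier :=
  X.hTotal.baseChange (S ⧸ seqIdeal f)

/-- The module `Coker (R ⊗ d)` of the higher matrix factorization. -/
abbrev hmfModule (X : HigherMatrixFactorization f) : Type u :=
  ((S ⧸ seqIdeal f) ⊗[S] X.A₀.carrier) ⧸ LinearMap.range X.dBar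

/-- The images of `d` and `h` lie in the maximal ideal times the target. -/
def IsMinimal [IsLocalRing S] (X : HigherMatrixFactorization f) : Prop :=
  LinearMap.range X.d ≤ IsLocalRing.maximalIdeal S • ⊤ ∧
    LinearMap.range X.hTotal ≤ IsLocalRing.maximalIdeal S • ⊤

/-- The composite `R(p-1) ⊗ A₀(p-1) → R(p-1) ⊗ A₀(p) → R(p-1) ⊗ A₁(p) → R(p-1) ⊗ B₁(p)` of the
inclusion, `h_p` and `π_p`. -/
abbrev stabMap (X : HigherMatrixFactorization f) (p : Fin c) :
    (S ⧸ prevIdeal f p) ⊗[S] X.A₀.fil p.castSucc →ₗ[S ⧸ prevIdeal f p]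
      (S ⧸ prevIdeal f p) ⊗[S] X.A₁.B p :=
  (X.A₁.π p).baseChange (S ⧸ prevIdeal f p) ∘ₗ (X.h p).baseChange (S ⧸ prevIdeal f p) ∘ₗ
    (X.A₀.incl p).baseChange (S ⧸ prevIdeal f p)

/-- The cokernel of `stabMap`, an `R(p-1)`-module. -/
abbrev stabCoker (X : HigherMatrixFactorization f) (p : Fin c) : Type u :=
  ((S ⧸ prevIdeal f p) ⊗[S] X.A₁.B p) ⧸ LinearMap.range (X.stabMap p)

/-- For each `p` the element `f_p` is a non-zerodivisor on `stabCoker p`. -/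
def IsPreStable (X : HigherMatrixFactorization f) : Prop :=
  ∀ p : Fin c, IsSMulRegular (X.stabCoker p) (f p)

/-- For each `p` the module `stabCoker p` is a maximal Cohen-Macaulay `R(p-1)`-module. -/
def IsStable (X : HigherMatrixFactorization f) : Prop :=
  ∀ p : Fin c, IsMaximalCohenMacaulay (S ⧸ prevIdeal f p) (X.stabCoker p)

/-- `d` and `h` are liftings to `S` of the first two differentials of `F`: up to isomorphisms of the
free modules, `R ⊗ d` and `R ⊗ h` are these differentials. -/
def LiftsFirstTwo [IsLocalRing S] (X : HigherMatrixFactorization f)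
    (F : MinimalFreeResolution (seqIdeal f)) : Prop :=
  ∃ (e₀ : (Fin (F.rank 0) → S ⧸ seqIdeal f) ≃ₗ[S ⧸ seqIdeal f]
        (S ⧸ seqIdeal f) ⊗[S] X.A₀.carrier)
    (e₁ : (Fin (F.rank 1) → S ⧸ seqIdeal f) ≃ₗ[S ⧸ seqIdeal f]
        (S ⧸ seqIdeal f) ⊗[S] X.A₁.carrier)
    (e₂ : (Fin (F.rank 2) → S ⧸ seqIdeal f) ≃ₗ[S ⧸ seqIdeal f]
        (S ⧸ seqIdeal f) ⊗[S] X.hSource),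
    e₀.toLinearMap ∘ₗ (F.δ 0).mulVecLin = X.dBar ∘ₗ e₁.toLinearMap ∧
    e₁.toLinearMap ∘ₗ (F.δ 1).mulVecLin = X.hBar ∘ₗ e₂.toLinearMap

end HigherMatrixFactorization

/-! Induct on `c`. Put R' = S/(f₁,…,f_{c-1}) and r = f_c, and let F be the minimal R-resolution of L
with M = Ker(F₁ → F₀). Reducing the given lifting of F and the last CI operator to R' gives maps D
and t over R' with D² = r t. By Nakayama t is still surjective, and since r is regular on R',
cancelling r shows that t commutes with D.

Let G_i = Ker(t : F_{i+2} → F_i) over R'. Surjectivity of t and exactness of F modulo r make G, with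
differential D, a minimal R'-resolution of M' = Ker(F₁ → F₀) over R'. By definition M' is a syzygy
of the same type for f₁,…,f_{c-1}, so by induction there is a factorization (d', h') whose reduction
to R' is, by uniqueness of minimal resolutions, G₂ → G₁ → G₀.

A section s of t splits F_{i+2} = G_i ⊕ F_i. Hence A₀ = A₀' × S^{rank F₀} reduces to F₂ and A₁ = A₁'
× S^{rank F₁} to F₃, while the source of h, namely the old source plus A₀, reduces to G₂ ⊕ F₂ = F₄.
Let d lift D : F₃ → F₂ and let the new homotopy k lift D s : F₂ → F₄ → F₃. The two congruences
become D D s = r t s = r and t D s D = D t s D = D² = r t, because modulo the ideal of R' the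
projection A₁ → A₁/A₁' is t. The shifted complex F₄ → F₃ → F₂ starts the minimal resolution of M,
which gives the module, the minimality and the lifting property (`exists_extension`,
`exists_ambientHMF`).

Since t D s = D, the module C_c is F₁/D(G₀) = F₁/Ker D, isomorphic to the image of D : F₁ → F₀ over
R'. It lies in a free R'-module, so r is regular on it. For stability, r F₀ ⊆ Im D gives L = F₀/Im
D, so Im D is the first R'-syzygy of a maximal Cohen-Macaulay R-module. The depth lemma applies when
R' is Cohen-Macaulay, but S is not assumed to be so. The induction therefore carries a dichotomy:
the syzygy vanishes or the ring modulo the sequence is Cohen-Macaulay. If M' = 0 and F₀ ≠ 0, then 0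
→ F₁ → F₀ → L → 0 is a minimal resolution over R', and depth R' = depth L + 1 follows from the
vanishing of Ext(k, F₁) → Ext(k, F₀); this makes R' Cohen-Macaulay (`isMCMOver_range`). -/

/-! ### Reduction of modules modulo an ideal -/

/-- A surjective linear map whose kernel is `I • ⊤`: it presents its target as the reduction of its
source modulo `I`. -/
structure IsReduction {S : Type*} [CommRing S] (I : Ideal S) {A F : Type*} [AddCommGroup A]
    [Module S A] [AddCommGroup F] [Module S F] (ρ : A →ₗ[S] F) : Prop where
  surjective : Function.Surjective ρ
  ker_eq : LinearMap.ker ρ = I • (⊤ : Submodule S A)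

namespace IsReduction

variable {S : Type*} [CommRing S] {I J K : Ideal S} {A A' B F F' F₀ : Type*}
  [AddCommGroup A] [Module S A] [AddCommGroup A'] [Module S A'] [AddCommGroup B] [Module S B]
  [AddCommGroup F] [Module S F] [AddCommGroup F'] [Module S F'] [AddCommGroup F₀] [Module S F₀]

theorem eq_zero_iff {ρ : A →ₗ[S] F} (h : IsReduction I ρ) {x : A} :
    ρ x = 0 ↔ x ∈ I • (⊤ : Submodule S A) := by
  rw [← h.ker_eq, LinearMap.mem_ker]

theorem comp {ρ : A →ₗ[S] F} {g : F →ₗ[S] F'} (hg : IsReduction K g) (hρ : IsReduction J ρ) :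
    IsReduction (J ⊔ K) (g ∘ₗ ρ) where
  surjective := hg.surjective.comp hρ.surjective
  ker_eq := by
    rw [LinearMap.ker_comp, hg.ker_eq, Submodule.comap_smul_top_of_surjective _ _ hρ.surjective,
      hρ.ker_eq, ← Submodule.sup_smul, sup_comm]

theorem comp_equiv {ρ : A →ₗ[S] F} (hρ : IsReduction I ρ) (e : B ≃ₗ[S] A) :
    IsReduction I (ρ ∘ₗ e.toLinearMap) where
  surjective := hρ.surjective.comp e.surjective
  ker_eq := by
    ext x
    rw [LinearMap.mem_ker, LinearMap.comp_apply, hρ.eq_zero_iff]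
    have : Submodule.map e.toLinearMap (I • ⊤) = I • (⊤ : Submodule S A) := by
      rw [Submodule.map_smul'', Submodule.map_top, LinearEquiv.range]
    rw [← this]
    exact Submodule.mem_map.trans ⟨fun ⟨y, hy, hyx⟩ ↦ e.injective hyx ▸ hy, fun h ↦ ⟨x, h, rfl⟩⟩

/-- Reductions of the kernel and of the target of a split surjection glue to a reduction of its
source. -/
theorem coprod {ρ' : A' →ₗ[S] F} {ρB : B →ₗ[S] F₀} {t : F →ₗ[S] F₀} {s : F₀ →ₗ[S] F}
    (hts : ∀ x, t (s x) = x) (hrange : LinearMap.range ρ' = LinearMap.ker t)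
    (hker : LinearMap.ker ρ' = I • ⊤) (hB : IsReduction I ρB) :
    IsReduction I (ρ'.coprod (s ∘ₗ ρB)) where
  surjective x := by
    obtain ⟨b, hb⟩ := hB.surjective (t x)
    have : x - s (t x) ∈ LinearMap.range ρ' := by
      rw [hrange, LinearMap.mem_ker, map_sub, hts, sub_self]
    obtain ⟨a, ha⟩ := this
    exact ⟨(a, b), by simp [ha, hb]⟩
  ker_eq := by
    have key : ∀ a, t (ρ' a) = 0 := fun a ↦ by
      have : ρ' a ∈ LinearMap.ker t := hrange ▸ ⟨a, rfl⟩
      exact this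
    apply le_antisymm
    · rintro ⟨a, b⟩ hab
      have h1 : ρ' a + s (ρB b) = 0 := by simpa using hab
      have hb : ρB b = 0 := by
        have := congrArg t h1
        simpa [key, hts] using this
      have ha : ρ' a = 0 := by simpa [hb] using h1
      have ha' : a ∈ I • (⊤ : Submodule S A') := by rw [← hker]; exact ha
      have hb' : b ∈ I • (⊤ : Submodule S B) := hB.eq_zero_iff.1 hb
      have : ((a, b) : A' × B) = LinearMap.inl S A' B a + LinearMap.inr S A' B b := by simp
      rw [this]
      refine add_mem ?_ ?_
      · have := Submodule.mem_map_of_mem (f := LinearMap.inl S A' B) ha'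
        rw [Submodule.map_smul''] at this
        exact Submodule.smul_mono le_rfl le_top this
      · have := Submodule.mem_map_of_mem (f := LinearMap.inr S A' B) hb'
        rw [Submodule.map_smul''] at this
        exact Submodule.smul_mono le_rfl le_top this
    · rw [Submodule.smul_le]
      rintro r hr ⟨a, b⟩ -
      have ha : ρ' (r • a) = 0 := by
        have : r • a ∈ LinearMap.ker ρ' := by
          rw [hker]; exact Submodule.smul_mem_smul hr trivial
        exact this
      have hb : ρB (r • b) = 0 := hB.eq_zero_iff.2 (Submodule.smul_mem_smul hr trivial)
      simp [← map_smul, -LinearMap.map_smul_of_tower, ha, hb]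

/-- A reduction modulo `I` identifies its target with the base change of its source. -/
theorem exists_equiv_baseChange [Module (S ⧸ I) F] [IsScalarTower S (S ⧸ I) F] {ρ : A →ₗ[S] F}
    (h : IsReduction I ρ) :
    ∃ e : F ≃ₗ[S ⧸ I] (S ⧸ I) ⊗[S] A, ∀ a, e (ρ a) = 1 ⊗ₜ a := by
  have hsurj : ∀ y : (S ⧸ I) ⊗[S] A, ∃ a : A, y = 1 ⊗ₜ a := by
    intro y
    induction y with
    | zero => exact ⟨0, by simp⟩
    | add x y hx hy =>
      obtain ⟨a, rfl⟩ := hx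
      obtain ⟨b, rfl⟩ := hy
      exact ⟨a + b, by rw [TensorProduct.tmul_add]⟩
    | tmul r a =>
      obtain ⟨s, rfl⟩ := Ideal.Quotient.mk_surjective r
      refine ⟨s • a, ?_⟩
      rw [TensorProduct.tmul_smul, TensorProduct.smul_tmul', ← Ideal.Quotient.algebraMap_eq,
        Algebra.algebraMap_eq_smul_one]
  have hval : ∀ a, LinearMap.liftBaseChange (S ⧸ I) ρ (1 ⊗ₜ a) = ρ a := by simp
  have hzero : ∀ a ∈ I • (⊤ : Submodule S A), (1 : S ⧸ I) ⊗ₜ[S] a = 0 := by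
    intro a ha
    have : I • (⊤ : Submodule S A) ≤ LinearMap.ker (TensorProduct.mk S (S ⧸ I) A 1) := by
      rw [Submodule.smul_le]
      intro r hr x _
      rw [LinearMap.mem_ker, TensorProduct.mk_apply, TensorProduct.tmul_smul,
        TensorProduct.smul_tmul', ← Algebra.algebraMap_eq_smul_one, Ideal.Quotient.algebraMap_eq,
        Ideal.Quotient.eq_zero_iff_mem.2 hr, TensorProduct.zero_tmul]
    exact this ha
  have hbij : Function.Bijective (LinearMap.liftBaseChange (S ⧸ I) ρ) := by
    constructor
    · rw [injective_iff_map_eq_zero]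
      intro y hy
      obtain ⟨a, rfl⟩ := hsurj y
      rw [hval] at hy
      exact hzero a (h.eq_zero_iff.1 hy)
    · intro x
      obtain ⟨a, rfl⟩ := h.surjective x
      exact ⟨_, hval a⟩
  refine ⟨(LinearEquiv.ofBijective _ hbij).symm, fun a ↦ ?_⟩
  rw [LinearEquiv.symm_apply_eq, LinearEquiv.ofBijective_apply, hval]

/-- A map whose reduction has image in `𝔪 F` has image in `𝔪 A`, if `I ≤ 𝔪`. -/
theorem range_le_smul_top {𝔪 : Ideal S} (hI : I ≤ 𝔪) {ρ : A →ₗ[S] F} (h : IsReduction I ρ)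
    {d : B →ₗ[S] A} (hd : ∀ b, ρ (d b) ∈ 𝔪 • (⊤ : Submodule S F)) :
    LinearMap.range d ≤ 𝔪 • ⊤ := by
  rintro _ ⟨b, rfl⟩
  have := hd b
  rw [← Submodule.mem_comap, Submodule.comap_smul_top_of_surjective _ _ h.surjective,
    h.ker_eq, ← Submodule.sup_smul, sup_eq_left.2 hI] at this
  exact this

end IsReduction

/-- The coordinatewise reduction `Sⁿ → (S ⧸ I)ⁿ`. -/
def quotPi {S : Type*} [CommRing S] (I : Ideal S) (n : ℕ) :
    (Fin n → S) →ₗ[S] (Fin n → S ⧸ I) :=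
  LinearMap.compLeft I.mkQ (Fin n)

theorem mem_smul_top_pi {S : Type*} [CommRing S] {I : Ideal S} {n : ℕ} {M : Type*}
    [AddCommGroup M] [Module S M] {x : Fin n → M} (h : ∀ i, x i ∈ I • (⊤ : Submodule S M)) :
    x ∈ I • (⊤ : Submodule S (Fin n → M)) := by
  rw [← Finset.univ_sum_single x]
  refine sum_mem fun i _ ↦ ?_
  have := Submodule.mem_map_of_mem (f := LinearMap.single S (fun _ : Fin n ↦ M) i) (h i)
  rw [Submodule.map_smul''] at this
  exact Submodule.smul_mono le_rfl le_top this

theorem mem_of_mem_smul_top_pi {S : Type*} [CommRing S] {I : Ideal S} {n : ℕ} {M : Type*}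
    [AddCommGroup M] [Module S M] {x : Fin n → M} (h : x ∈ I • (⊤ : Submodule S (Fin n → M)))
    (i : Fin n) : x i ∈ I • (⊤ : Submodule S M) := by
  have := Submodule.mem_map_of_mem (f := LinearMap.proj (R := S) (φ := fun _ : Fin n ↦ M) i) h
  rw [Submodule.map_smul''] at this
  exact Submodule.smul_mono le_rfl le_top this

theorem isReduction_quotPi {S : Type*} [CommRing S] (I : Ideal S) (n : ℕ) :
    IsReduction I (quotPi I n) where
  surjective x := by
    choose y hy using fun i ↦ Ideal.Quotient.mk_surjective (x i)
    exact ⟨y, funext hy⟩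
  ker_eq := by
    ext x
    have : x ∈ LinearMap.ker (quotPi I n) ↔ ∀ i, x i ∈ I := by
      rw [LinearMap.mem_ker, funext_iff]
      exact forall_congr' fun i ↦ Submodule.Quotient.mk_eq_zero I
    rw [this]
    refine ⟨fun h ↦ mem_smul_top_pi fun i ↦ by simpa using h i, fun h i ↦ ?_⟩
    simpa using mem_of_mem_smul_top_pi h i

/-! ### Uniqueness of minimal projective covers -/

section MinimalCovers

variable {R : Type*} [CommRing R] {𝔪 : Ideal R} {P Q P₁ Q₁ N N' : Type*}
  [AddCommGroup P] [Module R P] [AddCommGroup Q] [Module R Q] [AddCommGroup P₁] [Module R P₁]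
  [AddCommGroup Q₁] [Module R Q₁] [AddCommGroup N] [Module R N] [AddCommGroup N'] [Module R N']

theorem surjective_of_sub_mem_smul_top (h𝔪 : 𝔪 ≤ Ideal.jacobson ⊥) [Module.Finite R P]
    {a : P →ₗ[R] P} (ha : ∀ x, a x - x ∈ 𝔪 • (⊤ : Submodule R P)) : Function.Surjective a := by
  rw [← LinearMap.range_eq_top, ← top_le_iff]
  refine Submodule.le_of_le_smul_of_le_jacobson_bot Module.Finite.fg_top h𝔪 fun x _ ↦ ?_
  have : x = a x + -(a x - x) := by abel
  rw [this]
  exact Submodule.add_mem_sup ⟨x, rfl⟩ (neg_mem (ha x))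

/-- Minimal projective covers are unique. -/
theorem exists_equiv_of_minimal_cover (h𝔪 : 𝔪 ≤ Ideal.jacobson ⊥)
    [Module.Finite R P] [Module.Projective R P] [Module.Finite R Q] [Module.Projective R Q]
    {p : P →ₗ[R] N} {q : Q →ₗ[R] N'} (hp : Function.Surjective p) (hq : Function.Surjective q)
    (hp' : LinearMap.ker p ≤ 𝔪 • ⊤) (hq' : LinearMap.ker q ≤ 𝔪 • ⊤) (φ : N ≃ₗ[R] N') :
    ∃ u : P ≃ₗ[R] Q, ∀ x, q (u x) = φ (p x) := by
  obtain ⟨a, ha⟩ := Module.projective_lifting_property q (φ.toLinearMap ∘ₗ p) hq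
  obtain ⟨b, hb⟩ := Module.projective_lifting_property p (φ.symm.toLinearMap ∘ₗ q) hp
  have ha' : ∀ x, q (a x) = φ (p x) := fun x ↦ LinearMap.congr_fun ha x
  have hb' : ∀ x, p (b x) = φ.symm (q x) := fun x ↦ LinearMap.congr_fun hb x
  -- Each composite differs from the identity by a map into a kernel inside `𝔪 • ⊤`, so Nakayama
  -- makes it surjective. A surjective endomorphism of a finite module is injective, and the two
  -- composites together make `a` bijective.
  have hba : Function.Surjective (b ∘ₗ a) :=
    surjective_of_sub_mem_smul_top h𝔪 fun x ↦ hp' (by simp [ha', hb'])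
  have hab : Function.Surjective (a ∘ₗ b) :=
    surjective_of_sub_mem_smul_top h𝔪 fun x ↦ hq' (by simp [ha', hb'])
  have hinj : Function.Injective (b ∘ₗ a) :=
    OrzechProperty.injective_of_surjective_endomorphism _ hba
  refine ⟨LinearEquiv.ofBijective a ⟨?_, ?_⟩, ha'⟩
  · exact Function.Injective.of_comp (f := b) (by simpa using hinj)
  · exact Function.Surjective.of_comp (g := b) (by simpa using hab)

/-- The next step of the comparison of two minimal projective resolutions. -/
theorem exists_equiv_of_minimal_cover_range (h𝔪 : 𝔪 ≤ Ideal.jacobson ⊥)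
    [Module.Finite R P₁] [Module.Projective R P₁] [Module.Finite R Q₁] [Module.Projective R Q₁]
    {p : P₁ →ₗ[R] P} {q : Q₁ →ₗ[R] Q} (hp' : LinearMap.ker p ≤ 𝔪 • ⊤)
    (hq' : LinearMap.ker q ≤ 𝔪 • ⊤) (u : P ≃ₗ[R] Q)
    (hu : (LinearMap.range p).map u.toLinearMap = LinearMap.range q) :
    ∃ v : P₁ ≃ₗ[R] Q₁, ∀ x, q (v x) = u (p x) := by
  obtain ⟨v, hv⟩ := exists_equiv_of_minimal_cover h𝔪 p.surjective_rangeRestrict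
    q.surjective_rangeRestrict (by rwa [LinearMap.ker_rangeRestrict])
    (by rwa [LinearMap.ker_rangeRestrict])
    ((u.submoduleMap (LinearMap.range p)).trans (LinearEquiv.ofEq _ _ hu))
  refine ⟨v, fun x ↦ ?_⟩
  simpa using congrArg Subtype.val (hv x)

theorem map_ker_eq_of_comm {p : P →ₗ[R] N} {q : Q →ₗ[R] N'} {u : P ≃ₗ[R] Q} {φ : N →ₗ[R] N'}
    (hφ : Function.Injective φ) (h : ∀ x, q (u x) = φ (p x)) :
    (LinearMap.ker p).map u.toLinearMap = LinearMap.ker q := by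
  ext y
  constructor
  · rintro ⟨x, hx, rfl⟩
    have hx' : p x = 0 := hx
    simp [h, hx']
  · intro hy
    refine ⟨u.symm y, ?_, by simp⟩
    have hy' : q y = 0 := hy
    apply hφ
    rw [← h]
    simp [hy']

end MinimalCovers

/-! ### Depth through Ext, and maximal Cohen-Macaulay first syzygies -/

section Depth

open CategoryTheory Abelian RingTheory.Sequence

variable {S : Type u} [CommRing S] [IsLocalRing S]

/-- The vanishing of `Ext^i(k, N)` for `i < n`, where `k` is the residue field of `S`. -/
def DepthGE (S : Type u) [CommRing S] [IsLocalRing S] (n : ℕ) (N : Type u) [AddCommGroup N]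
    [Module S N] : Prop :=
  ∀ i < n, Subsingleton
    (Ext (ModuleCat.of S (S ⧸ IsLocalRing.maximalIdeal S)) (ModuleCat.of S N) i)

/-- `Subsingleton N`, or there is an `N`-regular sequence in `S` of length `dim (S ⧸ I)`. -/
def IsMCMOver {S : Type u} [CommRing S] (I : Ideal S) (N : Type u) [AddCommGroup N] [Module S N] :
    Prop :=
  Subsingleton N ∨ ∃ rs : List S, IsRegular N rs ∧
    ((rs.length : ℕ∞) : WithBot ℕ∞) = ringKrullDim (S ⧸ I)

theorem IsMCMOver.congr {S : Type u} [CommRing S] {I : Ideal S} {N N' : Type u} [AddCommGroup N]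
    [Module S N] [AddCommGroup N'] [Module S N'] (e : N ≃ₗ[S] N') (h : IsMCMOver I N) :
    IsMCMOver I N' := by
  rcases h with h | ⟨rs, h1, h2⟩
  · exact .inl e.symm.toEquiv.subsingleton
  · exact .inr ⟨rs, (e.isRegular_congr rs).1 h1, h2⟩

theorem isRegular_map_mk_iff {S : Type*} [CommRing S] {I : Ideal S} {N : Type*} [AddCommGroup N]
    [Module S N] [Module (S ⧸ I) N] [IsScalarTower S (S ⧸ I) N] (rs : List S) :
    IsRegular N (rs.map (Ideal.Quotient.mk I)) ↔ IsRegular N rs := by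
  have h := isWeaklyRegular_map_algebraMap_iff (S ⧸ I) N rs
  rw [Ideal.Quotient.algebraMap_eq] at h
  have key : (Ideal.ofList (rs.map (Ideal.Quotient.mk I)) • (⊤ : Submodule (S ⧸ I) N) = ⊤) ↔
      (Ideal.ofList rs • (⊤ : Submodule S N) = ⊤) := by
    rw [← Ideal.map_ofList, ← Ideal.Quotient.algebraMap_eq, ← Submodule.restrictScalars_eq_top_iff S,
      Ideal.smul_restrictScalars, Submodule.restrictScalars_top]
  constructor
  · exact fun H ↦ ⟨h.1 H.toIsWeaklyRegular, fun h' ↦ H.2 (key.2 h'.symm).symm⟩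
  · exact fun H ↦ ⟨h.2 H.toIsWeaklyRegular, fun h' ↦ H.2 (key.1 h'.symm).symm⟩

/-- Regular sequences in a quotient ring lift to `S`, so modules over different quotients of `S` can
all be compared through Ext over the one ring `S`. -/
theorem isMaximalCohenMacaulay_quotient_iff {S : Type u} [CommRing S] {I : Ideal S} {N : Type u}
    [AddCommGroup N] [Module S N] [Module (S ⧸ I) N] [IsScalarTower S (S ⧸ I) N] :
    IsMaximalCohenMacaulay (S ⧸ I) N ↔ Module.Finite (S ⧸ I) N ∧ IsMCMOver I N := by
  refine and_congr_right fun _ ↦ or_congr_right ⟨?_, ?_⟩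
  · rintro ⟨rs, h1, h2⟩
    obtain ⟨rs', rfl⟩ := List.map_surjective_iff.2 Ideal.Quotient.mk_surjective rs
    exact ⟨rs', (isRegular_map_mk_iff rs').1 h1, by simpa using h2⟩
  · rintro ⟨rs, h1, h2⟩
    exact ⟨rs.map (Ideal.Quotient.mk I), (isRegular_map_mk_iff rs).2 h1, by simpa using h2⟩

theorem mem_maximalIdeal_of_isRegular {S : Type*} [CommRing S] [IsLocalRing S] {N : Type*}
    [AddCommGroup N] [Module S N] {rs : List S} (h : IsRegular N rs) :
    ∀ r ∈ rs, r ∈ IsLocalRing.maximalIdeal S := by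
  intro r hr
  by_contra hu
  rw [IsLocalRing.notMem_maximalIdeal] at hu
  refine h.top_ne_smul ?_
  have : Ideal.ofList rs = ⊤ := Ideal.eq_top_of_isUnit_mem _ (Ideal.subset_span hr) hu
  rw [this, Submodule.top_smul]

/-- Rees' characterization of depth. A regular sequence in the present sense lies in the maximal
ideal automatically. -/
theorem depthGE_iff [IsNoetherianRing S] {N : Type u} [AddCommGroup N] [Module S N] [Module.Finite S N] [Nontrivial N]
    (n : ℕ) : DepthGE S n N ↔ ∃ rs : List S, IsRegular N rs ∧ rs.length = n := by
  have hsupp : Module.support S (S ⧸ IsLocalRing.maximalIdeal S) =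
      PrimeSpectrum.zeroLocus (IsLocalRing.maximalIdeal S) := by
    rw [Module.support_eq_zeroLocus, Ideal.annihilator_quotient]
  have hlt : IsLocalRing.maximalIdeal S • (⊤ : Submodule S N) < ⊤ :=
    (Submodule.top_ne_ideal_smul_of_le_jacobson_annihilator
      (IsLocalRing.maximalIdeal_le_jacobson _)).symm.lt_top
  constructor
  · intro h
    obtain ⟨rs, h1, -, h2⟩ := ModuleCat.exists_isRegular_of_exists_subsingleton_ext
      (IsLocalRing.maximalIdeal S) n (ModuleCat.of S N) hlt
      (ModuleCat.of S (S ⧸ IsLocalRing.maximalIdeal S)) hsupp h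
    exact ⟨rs, h2, h1⟩
  · rintro ⟨rs, h1, rfl⟩
    exact ModuleCat.subsingleton_ext_of_exists_isRegular (IsLocalRing.maximalIdeal S)
      (ModuleCat.of S (S ⧸ IsLocalRing.maximalIdeal S)) hsupp.le (ModuleCat.of S N) hlt rs
      (mem_maximalIdeal_of_isRegular h1) h1

theorem isMCMOver_iff [IsNoetherianRing S] {I : Ideal S} {n : ℕ} (hI : ringKrullDim (S ⧸ I) = n) {N : Type u}
    [AddCommGroup N] [Module S N] [Module.Finite S N] :
    IsMCMOver I N ↔ Subsingleton N ∨ DepthGE S n N := by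
  rcases subsingleton_or_nontrivial N with h | h
  · exact ⟨fun _ ↦ .inl h, fun _ ↦ .inl h⟩
  · refine or_congr_right ?_
    rw [depthGE_iff, hI]
    refine exists_congr fun rs ↦ and_congr_right fun _ ↦ ?_
    norm_cast

/-- Postcomposition of a class in `Ext` with linear maps, as a linear map. -/
noncomputable def extPostcomp {S : Type u} [CommRing S] {K : ModuleCat.{u} S} {N N' : Type u} [AddCommGroup N]
    [Module S N] [AddCommGroup N'] [Module S N'] {i : ℕ} (x : Ext K (ModuleCat.of S N) i) :
    (N →ₗ[S] N') →ₗ[S] Ext K (ModuleCat.of S N') i where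
  toFun φ := x.comp (Ext.mk₀ (ModuleCat.ofHom φ)) (add_zero i)
  map_add' φ ψ := by rw [ModuleCat.ofHom_add, Ext.mk₀_add, Ext.comp_add]
  map_smul' r φ := by
    rw [← Ext.comp_smul, ← Ext.mk₀_smul]
    rfl

theorem extPostcomp_comp {S : Type u} [CommRing S] {K : ModuleCat.{u} S} {N N' N'' : Type u}
    [AddCommGroup N] [Module S N] [AddCommGroup N'] [Module S N'] [AddCommGroup N'']
    [Module S N''] {i : ℕ} (x : Ext K (ModuleCat.of S N) i) (φ : N →ₗ[S] N') (ψ : N' →ₗ[S] N'') :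
    extPostcomp x (ψ ∘ₗ φ) = extPostcomp (extPostcomp x φ) ψ := by
  change x.comp (Ext.mk₀ (ModuleCat.ofHom φ ≫ ModuleCat.ofHom ψ)) (add_zero i) = _
  rw [← Ext.mk₀_comp_mk₀, ← Ext.comp_assoc_of_third_deg_zero]
  rfl

theorem extPostcomp_zero {S : Type u} [CommRing S] {K : ModuleCat.{u} S} {N N' : Type u}
    [AddCommGroup N] [Module S N] [AddCommGroup N'] [Module S N'] {i : ℕ} (φ : N →ₗ[S] N') :
    extPostcomp (0 : Ext K (ModuleCat.of S N) i) φ = 0 :=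
  Ext.zero_comp _ _ _ _ (add_zero i)

/-- Scalars act on Ext through either argument, and `r` acts as zero on `S ⧸ I`. -/
theorem smul_ext_eq_zero {S : Type u} [CommRing S] {I : Ideal S} {N : ModuleCat.{u} S} {i : ℕ}
    (x : Ext (ModuleCat.of S (S ⧸ I)) N i) {r : S} (hr : r ∈ I) : r • x = 0 := by
  have h : r • 𝟙 (ModuleCat.of S (S ⧸ I)) = 0 := by
    ext
    exact Ideal.Quotient.eq_zero_iff_mem.2 (I.mul_mem_right 1 hr)
  have : r • x = (Ext.mk₀ (r • 𝟙 (ModuleCat.of S (S ⧸ I)))).comp x (zero_add i) := by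
    rw [Ext.mk₀_smul, Ext.smul_comp, Ext.mk₀_id_comp]
  rw [this, h, Ext.mk₀_zero, Ext.zero_comp]

/-- The identity of `N ^ b` is a sum of maps factoring through `N`, so every class is a sum of
classes passing through a vanishing Ext group. -/
theorem DepthGE.pi {n : ℕ} {N : Type u} [AddCommGroup N] [Module S N] (h : DepthGE S n N) (b : ℕ) :
    DepthGE S n (Fin b → N) := by
  intro i hi
  have := h i hi
  refine subsingleton_of_forall_eq 0 fun x ↦ ?_
  have hid : (LinearMap.id : (Fin b → N) →ₗ[S] (Fin b → N)) =
      ∑ k, (LinearMap.single S (fun _ ↦ N) k) ∘ₗ LinearMap.proj k := by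
    ext k y l
    simp [Pi.single_apply, Finset.sum_apply]
  have hx : x = extPostcomp x LinearMap.id := (Ext.comp_mk₀_id x).symm
  rw [hx, hid, map_sum]
  refine Finset.sum_eq_zero fun k _ ↦ ?_
  rw [extPostcomp_comp, Subsingleton.elim (extPostcomp x _) 0, extPostcomp_zero]

theorem DepthGE.of_pi {n b : ℕ} {N : Type u} [AddCommGroup N] [Module S N]
    (h : DepthGE S n (Fin b → N)) (k : Fin b) : DepthGE S n N := by
  intro i hi
  have := h i hi
  refine subsingleton_of_forall_eq 0 fun x ↦ ?_
  have hid : (LinearMap.id : N →ₗ[S] N) =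
      LinearMap.proj k ∘ₗ (LinearMap.single S (fun _ : Fin b ↦ N) k) := by
    ext y
    simp
  have hx : x = extPostcomp x LinearMap.id := (Ext.comp_mk₀_id x).symm
  rw [hx, hid]
  rw [extPostcomp_comp, Subsingleton.elim (extPostcomp x _) 0, extPostcomp_zero]

section ShortExact

variable {A B C : Type u} [AddCommGroup A] [Module S A] [AddCommGroup B] [Module S B]
  [AddCommGroup C] [Module S C] {φ : A →ₗ[S] B} {ψ : B →ₗ[S] C}

omit [IsLocalRing S] in
theorem shortExact_of_exact (hφ : Function.Injective φ) (hex : Function.Exact φ ψ)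
    (hψ : Function.Surjective ψ) :
    (ShortComplex.mk (ModuleCat.ofHom φ) (ModuleCat.ofHom ψ)
      (by ext x; exact hex.apply_apply_eq_zero x)).ShortExact where
  exact := (ShortComplex.ShortExact.moduleCat_exact_iff_function_exact _).mpr hex
  mono_f := (ModuleCat.mono_iff_injective _).2 hφ
  epi_g := (ModuleCat.epi_iff_surjective _).2 hψ

theorem DepthGE.of_shortExact_left {n : ℕ} (hφ : Function.Injective φ) (hex : Function.Exact φ ψ)
    (hψ : Function.Surjective ψ) (hB : DepthGE S (n + 1) B) (hC : DepthGE S n C) :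
    DepthGE S (n + 1) A := by
  intro i hi
  have := hB i hi
  refine subsingleton_of_forall_eq 0 fun x ↦ ?_
  have hS := shortExact_of_exact hφ hex hψ
  have hx : x.comp (Ext.mk₀ (ModuleCat.ofHom φ)) (add_zero i) = 0 := Subsingleton.elim _ _
  rcases i with _ | i
  · have := hS.mono_f
    exact Ext.postcomp_mk₀_injective_of_mono _ (ModuleCat.ofHom φ)
      (by rw [map_zero]; exact hx)
  · have := hC i (by omega)
    obtain ⟨y, rfl⟩ := Ext.covariant_sequence_exact₁ _ hS x hx rfl
    rw [Subsingleton.elim y 0, Ext.zero_comp]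

theorem DepthGE.of_shortExact_right {n : ℕ} (hφ : Function.Injective φ) (hex : Function.Exact φ ψ)
    (hψ : Function.Surjective ψ) (hA : DepthGE S (n + 1) A) (hB : DepthGE S n B) :
    DepthGE S n C := by
  intro i hi
  have := hB i hi
  have := hA (i + 1) (by omega)
  refine subsingleton_of_forall_eq 0 fun x ↦ ?_
  have hS := shortExact_of_exact hφ hex hψ
  obtain ⟨y, rfl⟩ := Ext.covariant_sequence_exact₃ _ hS x rfl (Subsingleton.elim _ _)
  rw [Subsingleton.elim y 0, Ext.zero_comp]

/-- Postcomposition is linear in the map and the maximal ideal kills Ext(k, -), so `φ` induces zero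
on Ext. Each class of Ext^i(k, A) then comes from Ext^{i-1}(k, C) by the connecting map; in degree 0
it vanishes because Hom(k, -) preserves injections. No depth of `B` is needed, which is how the
depth of the base ring is bounded below later. -/
theorem DepthGE.of_shortExact_left_of_mem {n : ℕ} (hφ : Function.Injective φ)
    (hex : Function.Exact φ ψ) (hψ : Function.Surjective ψ)
    (hmem : φ ∈ IsLocalRing.maximalIdeal S • (⊤ : Submodule S (A →ₗ[S] B)))
    (hC : DepthGE S n C) : DepthGE S (n + 1) A := by
  intro i hi
  refine subsingleton_of_forall_eq 0 fun x ↦ ?_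
  have hS := shortExact_of_exact hφ hex hψ
  have hx : x.comp (Ext.mk₀ (ModuleCat.ofHom φ)) (add_zero i) = 0 := by
    change φ ∈ LinearMap.ker (extPostcomp (N' := B) x)
    refine Submodule.smul_le.2 (fun r hr g _ ↦ ?_) hmem
    rw [LinearMap.mem_ker, map_smul, smul_ext_eq_zero _ hr]
  rcases i with _ | i
  · have := hS.mono_f
    exact Ext.postcomp_mk₀_injective_of_mono _ (ModuleCat.ofHom φ)
      (by rw [map_zero]; exact hx)
  · have := hC i (by omega)
    obtain ⟨y, rfl⟩ := Ext.covariant_sequence_exact₁ _ hS x hx rfl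
    rw [Subsingleton.elim y 0, Ext.zero_comp]

end ShortExact

/-- Multiplication by a regular element presents the quotient by it. -/
theorem exact_mul_factor {S : Type*} [CommRing S] (J : Ideal S) (r : S) :
    Function.Exact (r • (LinearMap.id : (S ⧸ J) →ₗ[S] (S ⧸ J)))
      (Submodule.factor (le_sup_left : J ≤ J ⊔ Ideal.span {r})) := by
  intro x
  obtain ⟨x, rfl⟩ := Ideal.Quotient.mk_surjective x
  constructor
  · intro h
    have h' : x ∈ J ⊔ Ideal.span {r} := (Submodule.Quotient.mk_eq_zero _).1 h
    obtain ⟨y, hy, z, hz, rfl⟩ := Submodule.mem_sup.1 h'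
    obtain ⟨w, rfl⟩ := Ideal.mem_span_singleton'.1 hz
    refine ⟨Ideal.Quotient.mk J w, ?_⟩
    have : (Ideal.Quotient.mk J) (y + w * r) = Ideal.Quotient.mk J (r * w) := by
      rw [map_add, Ideal.Quotient.eq_zero_iff_mem.2 hy, zero_add, mul_comm]
    rw [this]
    rfl
  · rintro ⟨y, hy⟩
    obtain ⟨y, rfl⟩ := Ideal.Quotient.mk_surjective y
    rw [← hy]
    refine (Submodule.Quotient.mk_eq_zero _).2 ?_
    exact Ideal.mul_mem_right _ _ (Ideal.mem_sup_right (Ideal.mem_span_singleton_self r))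

theorem map_maximalIdeal_ne_top {S : Type*} [CommRing S] [IsLocalRing S] {J : Ideal S}
    (hJ : J ≤ IsLocalRing.maximalIdeal S) :
    (IsLocalRing.maximalIdeal S).map (Ideal.Quotient.mk J) ≠ ⊤ := by
  intro h
  have := congrArg (Ideal.comap (Ideal.Quotient.mk J)) h
  rw [Ideal.comap_map_of_surjective _ Ideal.Quotient.mk_surjective, Ideal.comap_top,
    ← RingHom.ker_eq_comap_bot, Ideal.mk_ker, sup_eq_left.2 hJ] at this
  exact (IsLocalRing.maximalIdeal.isMaximal S).ne_top this

theorem ringKrullDim_quotient_sup_succ [IsNoetherianRing S] {J : Ideal S} {r : S}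
    (hJ : J ≤ IsLocalRing.maximalIdeal S) (hr : r ∈ IsLocalRing.maximalIdeal S)
    (hreg : IsSMulRegular (S ⧸ J) r) :
    ringKrullDim (S ⧸ J ⊔ Ideal.span {r}) + 1 = ringKrullDim (S ⧸ J) := by
  have : Nontrivial (S ⧸ J) := Ideal.Quotient.nontrivial_iff.2
    fun h ↦ IsLocalRing.maximalIdeal.isMaximal S |>.ne_top (top_le_iff.1 (h ▸ hJ))
  have := IsLocalRing.of_surjective' (Ideal.Quotient.mk J) Ideal.Quotient.mk_surjective
  have h1 : IsSMulRegular (S ⧸ J) (Ideal.Quotient.mk J r) := fun x y hxy ↦ hreg hxy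
  have h2 : Ideal.Quotient.mk J r ∈ IsLocalRing.maximalIdeal (S ⧸ J) :=
    IsLocalRing.le_maximalIdeal (map_maximalIdeal_ne_top hJ)
      (Ideal.mem_map_of_mem _ hr)
  rw [← ringKrullDim_quotient_span_singleton_succ_eq_ringKrullDim h1 h2,
    ← ringKrullDim_eq_of_ringEquiv (DoubleQuot.quotQuotEquivQuotSup J (Ideal.span {r})),
    Ideal.map_span, Set.image_singleton]

/-- The matrix is the sum of its entries times elementary matrices. Membership in `I • Hom`, rather
than only of the image in `I • ⊤`, is what makes the induced map on Ext vanish. -/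
theorem mulVecLin_mem_smul_top {S : Type*} [CommRing S] {I J : Ideal S} {a b : ℕ}
    {A : Matrix (Fin b) (Fin a) (S ⧸ J)} (hA : ∀ k l, A k l ∈ I.map (Ideal.Quotient.mk J)) :
    A.mulVecLin.restrictScalars S ∈
      I • (⊤ : Submodule S ((Fin a → S ⧸ J) →ₗ[S] (Fin b → S ⧸ J))) := by
  have : A.mulVecLin.restrictScalars S = ∑ k, ∑ l,
      LinearMap.single S (fun _ : Fin b ↦ S ⧸ J) k ∘ₗ
        (LinearMap.lsmul (S ⧸ J) (S ⧸ J) (A k l)).restrictScalars S ∘ₗ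
        LinearMap.proj (R := S) (φ := fun _ : Fin a ↦ S ⧸ J) l := by
    refine LinearMap.ext fun x ↦ funext fun i ↦ ?_
    simp [Matrix.mulVec, dotProduct, LinearMap.sum_apply, Finset.sum_apply, Pi.single_apply,
      Finset.sum_ite_eq]
  rw [this]
  refine sum_mem fun k _ ↦ sum_mem fun l _ ↦ ?_
  obtain ⟨s, hs, hsA⟩ := (Ideal.mem_map_iff_of_surjective _ Ideal.Quotient.mk_surjective).1 (hA k l)
  have : LinearMap.single S (fun _ : Fin b ↦ S ⧸ J) k ∘ₗ
      (LinearMap.lsmul (S ⧸ J) (S ⧸ J) (A k l)).restrictScalars S ∘ₗ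
        LinearMap.proj (R := S) (φ := fun _ : Fin a ↦ S ⧸ J) l =
      s • (LinearMap.single S (fun _ : Fin b ↦ S ⧸ J) k ∘ₗ
        LinearMap.proj (R := S) (φ := fun _ : Fin a ↦ S ⧸ J) l) := by
    refine LinearMap.ext fun x ↦ ?_
    rw [LinearMap.smul_apply, LinearMap.comp_apply, LinearMap.comp_apply, LinearMap.comp_apply,
      ← map_smul, ← hsA]
    rfl
  rw [this]
  exact Submodule.smul_mem_smul hs trivial

theorem mulVec_mem_smul_top {S : Type*} [CommRing S] {I J : Ideal S} {a b : ℕ}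
    {A : Matrix (Fin b) (Fin a) (S ⧸ J)} (hA : ∀ k l, A k l ∈ I.map (Ideal.Quotient.mk J))
    (x : Fin a → S ⧸ J) :
    A.mulVecLin x ∈ I • (⊤ : Submodule S (Fin b → S ⧸ J)) := by
  have := Submodule.mem_map_of_mem (f := LinearMap.applyₗ x) (mulVecLin_mem_smul_top hA)
  rw [Submodule.map_smul''] at this
  exact Submodule.smul_mono le_rfl le_top this

theorem exists_ringKrullDim_quotient_eq [IsNoetherianRing S] {I : Ideal S}
    (hI : I ≤ IsLocalRing.maximalIdeal S) : ∃ n : ℕ, ringKrullDim (S ⧸ I) = n := by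
  have hnt : Nontrivial (S ⧸ I) := Ideal.Quotient.nontrivial_iff.2
    fun h ↦ (IsLocalRing.maximalIdeal.isMaximal S).ne_top (top_le_iff.1 (h ▸ hI))
  have := IsLocalRing.of_surjective' (Ideal.Quotient.mk I) Ideal.Quotient.mk_surjective
  have h := finiteRingKrullDim_iff_ne_bot_and_top.1 (inferInstance : FiniteRingKrullDim (S ⧸ I))
  generalize ringKrullDim (S ⧸ I) = x at h
  induction x with
  | bot => exact absurd rfl h.1
  | coe m =>
    induction m with
    | top => exact absurd rfl h.2
    | coe m => exact ⟨m, rfl⟩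

section Syzygy

variable {J : Ideal S} {r : S} {a b n : ℕ} {A : Matrix (Fin b) (Fin a) (S ⧸ J)}

/-- The sequence 0 → F₁ → F₀ → L → 0 is minimal, so F₁ has depth one more than the bound for L; a
free summand of F₁ passes this on to the ring. -/
theorem depthGE_of_minimal_injective (hJ : J ≤ IsLocalRing.maximalIdeal S)
    (hreg : IsSMulRegular (S ⧸ J) r)
    (hA : ∀ k l, A k l ∈ (IsLocalRing.maximalIdeal S).map (Ideal.Quotient.mk J))
    (hrA : ∀ x, r • x ∈ LinearMap.range A.mulVecLin) (hb : 0 < b)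
    (hL : DepthGE S n ((Fin b → S ⧸ J) ⧸ LinearMap.range A.mulVecLin))
    (hinj : Function.Injective A.mulVecLin) : DepthGE S (n + 1) (S ⧸ J) := by
  have hntJ : Nontrivial (S ⧸ J) := Ideal.Quotient.nontrivial_iff.2
    fun h ↦ (IsLocalRing.maximalIdeal.isMaximal S).ne_top (top_le_iff.1 (h ▸ hJ))
  -- If F₁ = 0, then `r` kills F₀ ≠ 0, against the regularity of `r`.
  rcases Nat.eq_zero_or_pos a with rfl | ha
  · exfalso
    obtain ⟨y, hy⟩ := hrA (fun _ ↦ 1)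
    have hy0 : y = 0 := Subsingleton.elim _ _
    rw [hy0, map_zero] at hy
    have h1 : r • (1 : S ⧸ J) = r • 0 := by
      rw [smul_zero]; exact (congrFun hy ⟨0, hb⟩).symm
    exact one_ne_zero (hreg h1)
  · exact DepthGE.of_pi (b := a) (DepthGE.of_shortExact_left_of_mem
      (φ := A.mulVecLin.restrictScalars S)
      (ψ := (LinearMap.range A.mulVecLin).mkQ.restrictScalars S) hinj
      (LinearMap.exact_map_mkQ_range A.mulVecLin)
      (Submodule.mkQ_surjective (LinearMap.range A.mulVecLin)) (mulVecLin_mem_smul_top hA) hL)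
      ⟨0, ha⟩

/-- Depth lemma for 0 → Im A → F₀ → L → 0. -/
theorem depthGE_range (hCM : DepthGE S (n + 1) (S ⧸ J))
    (hL : DepthGE S n ((Fin b → S ⧸ J) ⧸ LinearMap.range A.mulVecLin)) :
    DepthGE S (n + 1) (LinearMap.range A.mulVecLin) :=
  DepthGE.of_shortExact_left
    (φ := (LinearMap.range A.mulVecLin).subtype.restrictScalars S)
    (ψ := (LinearMap.range A.mulVecLin).mkQ.restrictScalars S) Subtype.val_injective
    (LinearMap.exact_subtype_mkQ (LinearMap.range A.mulVecLin))
    (Submodule.mkQ_surjective (LinearMap.range A.mulVecLin)) (hCM.pi b) hL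

theorem depthGE_quotient_sup (hreg : IsSMulRegular (S ⧸ J) r) (hCM : DepthGE S (n + 1) (S ⧸ J)) :
    DepthGE S n (S ⧸ J ⊔ Ideal.span {r}) :=
  DepthGE.of_shortExact_right (φ := r • (LinearMap.id : (S ⧸ J) →ₗ[S] (S ⧸ J)))
    (fun _ _ hxy ↦ hreg hxy) (exact_mul_factor J r) (Submodule.factor_surjective _) hCM
    fun i hi ↦ hCM i (by omega)

theorem eq_zero_of_subsingleton_coker [IsNoetherianRing S] (hJ : J ≤ IsLocalRing.maximalIdeal S)
    (hA : ∀ k l, A k l ∈ (IsLocalRing.maximalIdeal S).map (Ideal.Quotient.mk J))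
    (h : Subsingleton ((Fin b → S ⧸ J) ⧸ LinearMap.range A.mulVecLin)) : b = 0 := by
  have hntJ : Nontrivial (S ⧸ J) := Ideal.Quotient.nontrivial_iff.2
    fun h ↦ (IsLocalRing.maximalIdeal.isMaximal S).ne_top (top_le_iff.1 (h ▸ hJ))
  by_contra hb
  have hb' : Nonempty (Fin b) := ⟨⟨0, Nat.pos_of_ne_zero hb⟩⟩
  rw [Submodule.Quotient.subsingleton_iff] at h
  refine Submodule.top_ne_ideal_smul_of_le_jacobson_annihilator (R := S) (M := Fin b → S ⧸ J)
    (IsLocalRing.maximalIdeal_le_jacobson _) (top_le_iff.1 fun x _ ↦ ?_).symm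
  have : x ∈ LinearMap.range A.mulVecLin := by rw [h]; trivial
  obtain ⟨y, rfl⟩ := this
  exact mulVec_mem_smul_top hA y

/-- The first syzygy over `S ⧸ J` of a maximal Cohen-Macaulay module over `S ⧸ (J, r)`, where `r` is
regular on `S ⧸ J`: it is maximal Cohen-Macaulay if `S ⧸ J` is Cohen-Macaulay or the second syzygy
vanishes, and then `S ⧸ (J, r)` is Cohen-Macaulay unless the module vanishes. -/
theorem isMCMOver_range [IsNoetherianRing S]
    (hJ : J ≤ IsLocalRing.maximalIdeal S) (hr : r ∈ IsLocalRing.maximalIdeal S)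
    (hreg : IsSMulRegular (S ⧸ J) r)
    (hA : ∀ k l, A k l ∈ (IsLocalRing.maximalIdeal S).map (Ideal.Quotient.mk J))
    (hrA : ∀ x, r • x ∈ LinearMap.range A.mulVecLin)
    (hL : IsMCMOver (J ⊔ Ideal.span {r}) ((Fin b → S ⧸ J) ⧸ LinearMap.range A.mulVecLin))
    (hdich : Subsingleton (LinearMap.ker A.mulVecLin) ∨ IsMCMOver J (S ⧸ J)) :
    IsMCMOver J (LinearMap.range A.mulVecLin) ∧
      (b = 0 ∨ IsMCMOver (J ⊔ Ideal.span {r}) (S ⧸ J ⊔ Ideal.span {r})) := by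
  rcases Nat.eq_zero_or_pos b with rfl | hb
  · exact ⟨.inl inferInstance, .inl rfl⟩
  have hntJ : Nontrivial (S ⧸ J) := Ideal.Quotient.nontrivial_iff.2
    fun h ↦ (IsLocalRing.maximalIdeal.isMaximal S).ne_top (top_le_iff.1 (h ▸ hJ))
  obtain ⟨n, hn⟩ := exists_ringKrullDim_quotient_eq
    (sup_le hJ ((Ideal.span_singleton_le_iff_mem _).2 hr))
  have hn' : ringKrullDim (S ⧸ J) = (n + 1 : ℕ) := by
    rw [← ringKrullDim_quotient_sup_succ hJ hr hreg, hn]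
    norm_cast
  have hfin : Module.Finite S (LinearMap.range A.mulVecLin) := Module.Finite.trans (S ⧸ J) _
  have hL' : DepthGE S n ((Fin b → S ⧸ J) ⧸ LinearMap.range A.mulVecLin) :=
    ((isMCMOver_iff hn).1 hL).resolve_left
      fun h ↦ hb.ne' (eq_zero_of_subsingleton_coker hJ hA h)
  have hCM : DepthGE S (n + 1) (S ⧸ J) := by
    -- When the second syzygy vanishes, the Cohen-Macaulay property of `S ⧸ J` is not given but is
    -- forced by the module itself.
    rcases hdich with h | h
    · exact depthGE_of_minimal_injective hJ hreg hA hrA hb hL'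
        (LinearMap.ker_eq_bot.1 ((Submodule.subsingleton_iff_eq_bot).1 h))
    · exact ((isMCMOver_iff hn').1 h).resolve_left (not_subsingleton_iff_nontrivial.2 hntJ)
  exact ⟨(isMCMOver_iff hn').2 (.inr (depthGE_range hCM hL')),
    .inr ((isMCMOver_iff hn).2 (.inr (depthGE_quotient_sup hreg hCM)))⟩

end Syzygy

end Depth

/-! ### Higher matrix factorizations on ambient modules -/

theorem exists_eq_one_tmul {S : Type*} [CommRing S] {I : Ideal S} {A : Type*} [AddCommGroup A]
    [Module S A] (y : (S ⧸ I) ⊗[S] A) : ∃ a : A, y = 1 ⊗ₜ a := by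
  induction y with
  | zero => exact ⟨0, by simp⟩
  | add x y hx hy =>
    obtain ⟨a, rfl⟩ := hx
    obtain ⟨b, rfl⟩ := hy
    exact ⟨a + b, by rw [TensorProduct.tmul_add]⟩
  | tmul r a =>
    obtain ⟨s, rfl⟩ := Ideal.Quotient.mk_surjective r
    refine ⟨s • a, ?_⟩
    rw [TensorProduct.tmul_smul, TensorProduct.smul_tmul', ← Ideal.Quotient.algebraMap_eq,
      Algebra.algebraMap_eq_smul_one]

theorem one_tmul_eq_zero_iff {S : Type*} [CommRing S] {I : Ideal S} {A : Type*} [AddCommGroup A]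
    [Module S A] {a : A} : (1 : S ⧸ I) ⊗ₜ[S] a = 0 ↔ a ∈ I • (⊤ : Submodule S A) := by
  obtain ⟨e, he⟩ := IsReduction.exists_equiv_baseChange (I := I)
    (ρ := (I • (⊤ : Submodule S A)).mkQ) ⟨Submodule.mkQ_surjective _, Submodule.ker_mkQ _⟩
  rw [← he, LinearEquiv.map_eq_zero_iff, Submodule.mkQ_apply, Submodule.Quotient.mk_eq_zero]

/-- A higher matrix factorization whose homotopies `h_p` are given as maps `A₀ → A₁` that preserve
the `p`-th step of the filtration. -/
structure AmbientHMF {S : Type u} [CommRing S] {c : ℕ} (f : Fin c → S) where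
  A₀ : FilteredFreeModule S c
  A₁ : FilteredFreeModule S c
  d : A₁.carrier →ₗ[S] A₀.carrier
  d_fil : ∀ p, ∀ x ∈ A₁.fil p, d x ∈ A₀.fil p
  h : Fin c → A₀.carrier →ₗ[S] A₁.carrier
  h_fil : ∀ p : Fin c, ∀ x ∈ A₀.fil p.succ, h p x ∈ A₁.fil p.succ
  d_h : ∀ p : Fin c, ∀ x ∈ A₀.fil p.succ,
    d (h p x) - f p • x ∈ prevIdeal f p • A₀.fil p.succ
  h_d : ∀ p : Fin c, ∀ x ∈ A₁.fil p.succ,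
    h p (d x) - f p • x ∈ A₁.fil p.castSucc ⊔ prevIdeal f p • A₁.fil p.succ

namespace AmbientHMF

variable {S : Type u} [CommRing S] {c : ℕ} {f : Fin c → S}

/-- The submodule of `A₁(p)` whose quotient is the module `C_p`. -/
def stabKer (Y : AmbientHMF f) (p : Fin c) : Submodule S Y.A₁.carrier :=
  Y.A₁.fil p.castSucc ⊔ prevIdeal f p • Y.A₁.fil p.succ ⊔ (Y.A₀.fil p.castSucc).map (Y.h p)

/-- `f_p` is a non-zerodivisor on `C_p`. -/
def PreStableAt (Y : AmbientHMF f) (p : Fin c) : Prop :=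
  ∀ x ∈ Y.A₁.fil p.succ, f p • x ∈ Y.stabKer p → x ∈ Y.stabKer p

/-- `C_p` is maximal Cohen-Macaulay. -/
def StableAt (Y : AmbientHMF f) (p : Fin c) : Prop :=
  IsMCMOver (prevIdeal f p)
    (Y.A₁.fil p.succ ⧸ (Y.stabKer p).submoduleOf (Y.A₁.fil p.succ))

/-- The map `⨁_q A₀(q) → A₁`. -/
def hTotal (Y : AmbientHMF f) : (∀ p : Fin c, Y.A₀.fil p.succ) →ₗ[S] Y.A₁.carrier :=
  ∑ p : Fin c, Y.h p ∘ₗ (Y.A₀.fil p.succ).subtype ∘ₗ LinearMap.proj p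

theorem hTotal_apply (Y : AmbientHMF f) (x : ∀ p : Fin c, Y.A₀.fil p.succ) :
    Y.hTotal x = ∑ p, Y.h p (x p) := by
  simp [hTotal, LinearMap.sum_apply]

/-- The maps `d` and `h` reduce to the first two differentials of `F`. -/
def ReducesTo [IsLocalRing S] (Y : AmbientHMF f) (F : MinimalFreeResolution (seqIdeal f)) : Prop :=
  ∃ (ρ₀ : Y.A₀.carrier →ₗ[S] (Fin (F.rank 0) → S ⧸ seqIdeal f))
    (ρ₁ : Y.A₁.carrier →ₗ[S] (Fin (F.rank 1) → S ⧸ seqIdeal f))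
    (ρ₂ : (∀ p : Fin c, Y.A₀.fil p.succ) →ₗ[S] (Fin (F.rank 2) → S ⧸ seqIdeal f)),
    IsReduction (seqIdeal f) ρ₀ ∧ IsReduction (seqIdeal f) ρ₁ ∧ IsReduction (seqIdeal f) ρ₂ ∧
    (∀ x, ρ₀ (Y.d x) = (F.δ 0).mulVecLin (ρ₁ x)) ∧
    ∀ x, ρ₁ (Y.hTotal x) = (F.δ 1).mulVecLin (ρ₂ x)

/-- This turns congruences in the quotient B(p) into membership in submodules of A₁, so that the
construction can avoid quotients and subtypes. -/
theorem mem_mkQ_smul_top_iff {A : Type*} [AddCommGroup A] [Module S A] (I : Ideal S)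
    {V U : Submodule S A} (hVU : V ≤ U) (x : U) :
    (V.submoduleOf U).mkQ x ∈ I • (⊤ : Submodule S (U ⧸ V.submoduleOf U)) ↔
      (x : A) ∈ V ⊔ I • U := by
  rw [← Submodule.mem_comap, Submodule.comap_smul_top_of_surjective _ _ (Submodule.mkQ_surjective _),
    Submodule.ker_mkQ]
  have : (I • ⊤ ⊔ V.submoduleOf U).map U.subtype = V ⊔ I • U := by
    rw [Submodule.map_sup, Submodule.map_smul'', Submodule.map_top, Submodule.range_subtype,
      Submodule.submoduleOf, Submodule.map_comap_subtype, inf_eq_right.2 hVU, sup_comm]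
  rw [← this]
  exact (Function.Injective.mem_set_image U.injective_subtype).symm

/-- The associated higher matrix factorization. -/
abbrev toHMF (Y : AmbientHMF f) : HigherMatrixFactorization f where
  A₀ := Y.A₀
  A₁ := Y.A₁
  d := Y.d
  d_fil := Y.d_fil
  h p := (Y.h p).restrict (Y.h_fil p)
  d_h p x := by
    rw [Submodule.mem_smul_top_iff]
    exact Y.d_h p x x.2
  h_d p x := by
    rw [← map_smul, ← map_sub]
    exact (mem_mkQ_smul_top_iff _ (Y.A₁.fil_le p) _).2 (Y.h_d p x x.2)

/-- The projection of `A₁(p)` onto the module `C_p`. -/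
def stabProj (Y : AmbientHMF f) (p : Fin c) : Y.A₁.fil p.succ →ₗ[S] Y.toHMF.stabCoker p :=
  (LinearMap.range (Y.toHMF.stabMap p)).mkQ.restrictScalars S ∘ₗ
    TensorProduct.mk S (S ⧸ prevIdeal f p) _ 1 ∘ₗ Y.A₁.π p

theorem stabProj_surjective (Y : AmbientHMF f) (p : Fin c) :
    Function.Surjective (Y.stabProj p) := by
  intro y
  obtain ⟨y, rfl⟩ := Submodule.mkQ_surjective _ y
  obtain ⟨b, rfl⟩ := exists_eq_one_tmul y
  obtain ⟨x, rfl⟩ := Submodule.mkQ_surjective _ b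
  exact ⟨x, rfl⟩

/-- All tensors over `S ⧸ prevIdeal f p` have the form `1 ⊗ₜ a`. The kernel therefore collects
A₁(p-1), the ideal multiples, and the image of A₀(p-1) under `h p`. -/
theorem ker_stabProj (Y : AmbientHMF f) (p : Fin c) :
    LinearMap.ker (Y.stabProj p) = (Y.stabKer p).submoduleOf (Y.A₁.fil p.succ) := by
  ext x
  have h1 : x ∈ LinearMap.ker (Y.stabProj p) ↔
      (1 : S ⧸ prevIdeal f p) ⊗ₜ[S] Y.A₁.π p x ∈ LinearMap.range (Y.toHMF.stabMap p) :=
    Submodule.Quotient.mk_eq_zero _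
  have h2 : (1 : S ⧸ prevIdeal f p) ⊗ₜ[S] Y.A₁.π p x ∈ LinearMap.range (Y.toHMF.stabMap p) ↔
      ∃ a ∈ Y.A₀.fil p.castSucc, (x : Y.A₁.carrier) - Y.h p a ∈
        Y.A₁.fil p.castSucc ⊔ prevIdeal f p • Y.A₁.fil p.succ := by
    constructor
    · rintro ⟨y, hy⟩
      obtain ⟨a, rfl⟩ := exists_eq_one_tmul y
      refine ⟨a.1, a.2, ?_⟩
      have h3 : (1 : S ⧸ prevIdeal f p) ⊗ₜ[S]
          Y.A₁.π p (x - (Y.h p).restrict (Y.h_fil p) (Y.A₀.incl p a)) = 0 := by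
        rw [map_sub, TensorProduct.tmul_sub, ← hy, sub_eq_zero]
        rfl
      exact (mem_mkQ_smul_top_iff _ (Y.A₁.fil_le p) _).1 (one_tmul_eq_zero_iff.1 h3)
    · rintro ⟨a, ha, hax⟩
      refine ⟨1 ⊗ₜ ⟨a, ha⟩, ?_⟩
      have h3 : (1 : S ⧸ prevIdeal f p) ⊗ₜ[S]
          Y.A₁.π p (x - (Y.h p).restrict (Y.h_fil p) (Y.A₀.incl p ⟨a, ha⟩)) = 0 :=
        one_tmul_eq_zero_iff.2 ((mem_mkQ_smul_top_iff _ (Y.A₁.fil_le p) _).2 hax)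
      rw [map_sub, TensorProduct.tmul_sub, sub_eq_zero] at h3
      exact h3.symm
  rw [h1, h2, Submodule.submoduleOf, Submodule.mem_comap, Submodule.subtype_apply, stabKer,
    Submodule.mem_sup (p := _ ⊔ _)]
  constructor
  · rintro ⟨a, ha, hax⟩
    exact ⟨_, hax, _, ⟨a, ha, rfl⟩, sub_add_cancel _ _⟩
  · rintro ⟨y, hy, _, ⟨a, ha, rfl⟩, hx⟩
    exact ⟨a, ha, by rwa [← hx, add_sub_cancel_right]⟩

/-- `C_p` as a quotient of `A₁(p)`. -/
noncomputable def stabEquiv (Y : AmbientHMF f) (p : Fin c) :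
    (Y.A₁.fil p.succ ⧸ (Y.stabKer p).submoduleOf (Y.A₁.fil p.succ)) ≃ₗ[S] Y.toHMF.stabCoker p :=
  (Submodule.quotEquivOfEq _ _ (Y.ker_stabProj p).symm).trans
    ((Y.stabProj p).quotKerEquivOfSurjective (Y.stabProj_surjective p))

theorem isPreStable_toHMF {Y : AmbientHMF f} (hY : ∀ p, Y.PreStableAt p) : Y.toHMF.IsPreStable := by
  intro p
  rw [isSMulRegular_iff_right_eq_zero_of_smul]
  intro y hy
  obtain ⟨x, rfl⟩ := Y.stabProj_surjective p y
  have h1 : f p • x ∈ LinearMap.ker (Y.stabProj p) := by rw [LinearMap.mem_ker, map_smul]; exact hy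
  rw [ker_stabProj] at h1
  have h2 : x ∈ LinearMap.ker (Y.stabProj p) := by
    rw [ker_stabProj]
    exact hY p x x.2 h1
  exact h2

theorem isStable_toHMF [IsNoetherianRing S] {Y : AmbientHMF f} (hY : ∀ p, Y.StableAt p) :
    Y.toHMF.IsStable := fun p ↦
  isMaximalCohenMacaulay_quotient_iff.2
    ⟨inferInstance, (hY p).congr (Y.stabEquiv p)⟩

section

variable [IsLocalRing S] {Y : AmbientHMF f} {F : MinimalFreeResolution (seqIdeal f)}

theorem liftsFirstTwo_toHMF (h : Y.ReducesTo F) : Y.toHMF.LiftsFirstTwo F := by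
  obtain ⟨ρ₀, ρ₁, ρ₂, h₀, h₁, h₂, hd, hh⟩ := h
  obtain ⟨e₀, he₀⟩ := h₀.exists_equiv_baseChange
  obtain ⟨e₁, he₁⟩ := h₁.exists_equiv_baseChange
  obtain ⟨e₂, he₂⟩ := h₂.exists_equiv_baseChange
  refine ⟨e₀, e₁, e₂, LinearMap.ext fun x ↦ ?_, LinearMap.ext fun x ↦ ?_⟩
  · obtain ⟨x, rfl⟩ := h₁.surjective x
    exact ((congrArg e₀ (hd x).symm).trans (he₀ _)).trans (congrArg Y.toHMF.dBar (he₁ x)).symm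
  · obtain ⟨x, rfl⟩ := h₂.surjective x
    exact ((congrArg e₁ (hh x).symm).trans (he₁ _)).trans (congrArg Y.toHMF.hBar (he₂ x)).symm

/-- Membership in `𝔪 • ⊤` can be tested after a reduction modulo an ideal inside 𝔪, where it is the
minimality of `F`. -/
theorem isMinimal_toHMF (hf : seqIdeal f ≤ IsLocalRing.maximalIdeal S) (h : Y.ReducesTo F) :
    Y.toHMF.IsMinimal := by
  obtain ⟨ρ₀, ρ₁, ρ₂, h₀, h₁, h₂, hd, hh⟩ := h
  refine ⟨h₀.range_le_smul_top hf fun x ↦ ?_, h₁.range_le_smul_top hf fun x ↦ ?_⟩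
  · exact (hd x) ▸ mulVec_mem_smul_top (F.minimal 0) _
  · exact (hh x) ▸ mulVec_mem_smul_top (F.minimal 1) _

theorem resolved_equiv_hmfModule (h : Y.toHMF.LiftsFirstTwo F) :
    Nonempty (F.resolved ≃ₗ[S ⧸ seqIdeal f] Y.toHMF.hmfModule) := by
  obtain ⟨e₀, e₁, -, hd, -⟩ := h
  refine ⟨Submodule.Quotient.equiv _ _ e₀ ?_⟩
  rw [← LinearMap.range_comp, hd, LinearMap.range_comp_of_range_eq_top _ e₁.range]

end

end AmbientHMF

/-! ### Adding one step to a filtration and to a factorization -/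

namespace FilteredFreeModule

variable {S : Type u} [CommRing S] {c : ℕ}

theorem free_carrier (A : FilteredFreeModule S c) : Module.Free S A.carrier := by
  have := A.free (Fin.last c)
  rw [A.fil_last] at this
  exact Module.Free.of_equiv Submodule.topEquiv

/-- The filtration of `A × Sⁿ` by the submodules `A(p) × 0`, followed by `A × Sⁿ`. -/
def extendFil (A : FilteredFreeModule S c) (n : ℕ) (p : Fin (c + 2)) :
    Submodule S (A.carrier × (Fin n → S)) :=
  Fin.lastCases (motive := fun _ ↦ Submodule S (A.carrier × (Fin n → S))) ⊤
    (fun q ↦ (A.fil q).map (LinearMap.inl S A.carrier (Fin n → S))) p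

@[simp]
theorem extendFil_castSucc (A : FilteredFreeModule S c) (n : ℕ) (q : Fin (c + 1)) :
    A.extendFil n q.castSucc = (A.fil q).map (LinearMap.inl S A.carrier (Fin n → S)) := by
  simp [extendFil]

@[simp]
theorem extendFil_last (A : FilteredFreeModule S c) (n : ℕ) :
    A.extendFil n (Fin.last (c + 1)) = ⊤ := by
  simp [extendFil]

/-- The filtered module `A × Sⁿ`, with one more step than `A`. -/
abbrev extend (A : FilteredFreeModule S c) (n : ℕ) : FilteredFreeModule S (c + 1) where
  carrier := A.carrier × (Fin n → S)
  fil := A.extendFil n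
  fil_zero := by
    rw [← Fin.castSucc_zero, extendFil_castSucc, A.fil_zero, Submodule.map_bot]
  fil_last := A.extendFil_last n
  free p := by
    induction p using Fin.lastCases with
    | last =>
      rw [extendFil_last]
      have := A.free_carrier
      exact Module.Free.of_equiv Submodule.topEquiv.symm
    | cast q =>
      rw [extendFil_castSucc]
      have := A.free q
      exact Module.Free.of_equiv (Submodule.equivMapOfInjective _ LinearMap.inl_injective (A.fil q))
  summand p := by
    induction p using Fin.lastCases with
    | last =>
      refine ⟨LinearMap.range (LinearMap.inr S A.carrier (Fin n → S)), ?_⟩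
      rw [Fin.succ_last, extendFil_last, extendFil_castSucc, A.fil_last, Submodule.map_top]
      exact ⟨LinearMap.disjoint_inl_inr, LinearMap.sup_range_inl_inr⟩
    | cast q =>
      obtain ⟨N, h1, h2⟩ := A.summand q
      refine ⟨N.map (LinearMap.inl S A.carrier (Fin n → S)), ?_⟩
      rw [Fin.succ_castSucc, extendFil_castSucc, extendFil_castSucc]
      refine ⟨?_, by rw [← Submodule.map_sup, h2]⟩
      rw [disjoint_iff, ← Submodule.map_inf _ LinearMap.inl_injective, disjoint_iff.1 h1,
        Submodule.map_bot]

theorem fil_extend_castSucc (A : FilteredFreeModule S c) (n : ℕ) (q : Fin (c + 1)) :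
    (A.extend n).fil q.castSucc = (A.fil q).map (LinearMap.inl S A.carrier (Fin n → S)) :=
  A.extendFil_castSucc n q

theorem fil_extend_last (A : FilteredFreeModule S c) (n : ℕ) :
    (A.extend n).fil (Fin.last (c + 1)) = ⊤ :=
  A.extendFil_last n

end FilteredFreeModule

theorem prevIdeal_castSucc {S : Type u} [CommRing S] {c : ℕ} (f : Fin (c + 1) → S) (q : Fin c) :
    prevIdeal f q.castSucc = prevIdeal (dropLast f) q := by
  unfold prevIdeal
  congr 1
  ext x
  constructor
  · rintro ⟨j, hj, rfl⟩
    have hj' : j < q.castSucc := hj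
    refine ⟨⟨j, lt_trans hj' q.2⟩, ?_, rfl⟩
    exact hj'
  · rintro ⟨j, hj, rfl⟩
    exact ⟨j.castSucc, hj, rfl⟩

theorem prevIdeal_last {S : Type u} [CommRing S] {c : ℕ} (f : Fin (c + 1) → S) :
    prevIdeal f (Fin.last c) = seqIdeal (dropLast f) := by
  unfold prevIdeal seqIdeal
  congr 1
  ext x
  constructor
  · rintro ⟨j, hj, rfl⟩
    exact ⟨⟨j, hj⟩, rfl⟩
  · rintro ⟨j, rfl⟩
    exact ⟨j.castSucc, Fin.castSucc_lt_last j, rfl⟩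

theorem seqIdeal_eq_sup {S : Type u} [CommRing S] {c : ℕ} (f : Fin (c + 1) → S) :
    seqIdeal f = seqIdeal (dropLast f) ⊔ Ideal.span {f (Fin.last c)} := by
  rw [seqIdeal, seqIdeal, ← Ideal.span_union]
  congr 1
  ext x
  constructor
  · rintro ⟨j, rfl⟩
    induction j using Fin.lastCases with
    | last => exact .inr rfl
    | cast j => exact .inl ⟨j, rfl⟩
  · rintro (⟨j, rfl⟩ | rfl)
    · exact ⟨j.castSucc, rfl⟩
    · exact ⟨_, rfl⟩

theorem IsMCMOver.quotient_map {S : Type u} [CommRing S] {I I' : Ideal S} {A A' : Type u}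
    [AddCommGroup A] [Module S A] [AddCommGroup A'] [Module S A'] {j : A →ₗ[S] A'}
    (hj : Function.Injective j) {U K : Submodule S A} {U' K' : Submodule S A'}
    (hI : I' = I) (hU : U' = U.map j) (hK : K' = K.map j) (h : IsMCMOver I (U ⧸ K.submoduleOf U)) :
    IsMCMOver I' (U' ⧸ K'.submoduleOf U') := by
  subst hI hU hK
  refine h.congr (Submodule.Quotient.equiv _ _ (Submodule.equivMapOfInjective j hj U) ?_)
  ext ⟨x, hx⟩
  constructor
  · rintro ⟨y, hy, hyx⟩
    have : j y = x := congrArg Subtype.val hyx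
    exact ⟨y, hy, this⟩
  · rintro ⟨y, hy, hyx⟩
    obtain ⟨z, hz, hzx⟩ := hx
    obtain rfl : y = z := hj (hyx.trans hzx.symm)
    exact ⟨⟨y, hz⟩, hy, Subtype.ext hyx⟩

namespace AmbientHMF

variable {S : Type u} [CommRing S] {c : ℕ} {f : Fin (c + 1) → S}

/-- The inclusion `A₀ → A₀ × Sⁿ`. -/
abbrev inl₀ (Y : AmbientHMF (dropLast f)) (n : ℕ) :
    Y.A₀.carrier →ₗ[S] Y.A₀.carrier × (Fin n → S) :=
  LinearMap.inl S _ _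

/-- The inclusion `A₁ → A₁ × Sⁿ`. -/
abbrev inl₁ (Y : AmbientHMF (dropLast f)) (n : ℕ) :
    Y.A₁.carrier →ₗ[S] Y.A₁.carrier × (Fin n → S) :=
  LinearMap.inl S _ _

/-- The extension of `d` to `A₁ × Sⁿ¹` by a map on `Sⁿ¹`. -/
abbrev extendD (Y : AmbientHMF (dropLast f)) {n₀ n₁ : ℕ}
    (g : (Fin n₁ → S) →ₗ[S] Y.A₀.carrier × (Fin n₀ → S)) :
    Y.A₁.carrier × (Fin n₁ → S) →ₗ[S] Y.A₀.carrier × (Fin n₀ → S) :=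
  (Y.inl₀ n₀ ∘ₗ Y.d).coprod g

/-- The homotopies of an extension: the old ones, and one more. -/
def extendH (Y : AmbientHMF (dropLast f)) {n₀ n₁ : ℕ}
    (k : Y.A₀.carrier × (Fin n₀ → S) →ₗ[S] Y.A₁.carrier × (Fin n₁ → S)) (p : Fin (c + 1)) :
    Y.A₀.carrier × (Fin n₀ → S) →ₗ[S] Y.A₁.carrier × (Fin n₁ → S) :=
  Fin.lastCases
    (motive := fun _ ↦ Y.A₀.carrier × (Fin n₀ → S) →ₗ[S] Y.A₁.carrier × (Fin n₁ → S)) k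
    (fun q ↦ Y.inl₁ n₁ ∘ₗ Y.h q ∘ₗ LinearMap.fst S _ _) p

@[simp]
theorem extendH_castSucc (Y : AmbientHMF (dropLast f)) {n₀ n₁ : ℕ}
    (k : Y.A₀.carrier × (Fin n₀ → S) →ₗ[S] Y.A₁.carrier × (Fin n₁ → S)) (q : Fin c) :
    Y.extendH k q.castSucc = Y.inl₁ n₁ ∘ₗ Y.h q ∘ₗ LinearMap.fst S _ _ := by
  simp [extendH]

@[simp]
theorem extendH_last (Y : AmbientHMF (dropLast f)) {n₀ n₁ : ℕ}
    (k : Y.A₀.carrier × (Fin n₀ → S) →ₗ[S] Y.A₁.carrier × (Fin n₁ → S)) :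
    Y.extendH k (Fin.last c) = k := by
  simp [extendH]

/-- The extension of a higher matrix factorization with respect to `f₁, …, f_c` by a homotopy for
`f_{c+1}`. -/
abbrev extend (Y : AmbientHMF (dropLast f)) {n₀ n₁ : ℕ}
    (g : (Fin n₁ → S) →ₗ[S] Y.A₀.carrier × (Fin n₀ → S))
    (k : Y.A₀.carrier × (Fin n₀ → S) →ₗ[S] Y.A₁.carrier × (Fin n₁ → S))
    (hdk : ∀ x, Y.extendD g (k x) - f (Fin.last c) • x ∈
      seqIdeal (dropLast f) • (⊤ : Submodule S _))
    (hkd : ∀ x, k (Y.extendD g x) - f (Fin.last c) • x ∈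
      LinearMap.range (Y.inl₁ n₁) ⊔ seqIdeal (dropLast f) • (⊤ : Submodule S _)) :
    AmbientHMF f where
  A₀ := Y.A₀.extend n₀
  A₁ := Y.A₁.extend n₁
  d := Y.extendD g
  d_fil p x hx := by
    induction p using Fin.lastCases with
    | last => rw [FilteredFreeModule.fil_extend_last]; trivial
    | cast q =>
      rw [FilteredFreeModule.fil_extend_castSucc] at hx ⊢
      obtain ⟨y, hy, rfl⟩ := hx
      exact ⟨Y.d y, Y.d_fil q y hy, by simp⟩
  h := Y.extendH k
  h_fil p x hx := by
    induction p using Fin.lastCases with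
    | last => rw [Fin.succ_last, FilteredFreeModule.fil_extend_last]; trivial
    | cast q =>
      rw [Fin.succ_castSucc, FilteredFreeModule.fil_extend_castSucc] at hx ⊢
      obtain ⟨y, hy, rfl⟩ := hx
      exact ⟨Y.h q y, Y.h_fil q y hy, by simp⟩
  d_h p x hx := by
    induction p using Fin.lastCases with
    | last =>
      rw [Fin.succ_last, FilteredFreeModule.fil_extend_last, prevIdeal_last, extendH_last]
      exact hdk x
    | cast q =>
      rw [Fin.succ_castSucc, FilteredFreeModule.fil_extend_castSucc] at hx ⊢
      obtain ⟨y, hy, rfl⟩ := hx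
      rw [prevIdeal_castSucc, ← Submodule.map_smul'']
      exact ⟨_, Y.d_h q y hy, by simp⟩
  h_d p x hx := by
    induction p using Fin.lastCases with
    | last =>
      rw [Fin.succ_last, FilteredFreeModule.fil_extend_last, prevIdeal_last, extendH_last,
        FilteredFreeModule.fil_extend_castSucc, Y.A₁.fil_last, Submodule.map_top]
      exact hkd x
    | cast q =>
      rw [Fin.succ_castSucc, FilteredFreeModule.fil_extend_castSucc] at hx ⊢
      obtain ⟨y, hy, rfl⟩ := hx
      rw [prevIdeal_castSucc, FilteredFreeModule.fil_extend_castSucc, ← Submodule.map_smul'',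
        ← Submodule.map_sup]
      exact ⟨_, Y.h_d q y hy, by simp⟩

section

variable (Y : AmbientHMF (dropLast f)) {n₀ n₁ : ℕ}
  (g : (Fin n₁ → S) →ₗ[S] Y.A₀.carrier × (Fin n₀ → S))
  (k : Y.A₀.carrier × (Fin n₀ → S) →ₗ[S] Y.A₁.carrier × (Fin n₁ → S))
  (hdk : ∀ x, Y.extendD g (k x) - f (Fin.last c) • x ∈
    seqIdeal (dropLast f) • (⊤ : Submodule S _))
  (hkd : ∀ x, k (Y.extendD g x) - f (Fin.last c) • x ∈
    LinearMap.range (Y.inl₁ n₁) ⊔ seqIdeal (dropLast f) • (⊤ : Submodule S _))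

theorem h_extend_castSucc (q : Fin c) : (Y.extend g k hdk hkd).h q.castSucc =
    Y.inl₁ n₁ ∘ₗ Y.h q ∘ₗ LinearMap.fst S _ _ :=
  Y.extendH_castSucc k q

theorem h_extend_last : (Y.extend g k hdk hkd).h (Fin.last c) = k :=
  Y.extendH_last k

/-- The earlier steps of the extension are copies of the old ones, so the modules C_p for p < c, and
hence their stability, are inherited. -/
theorem stabKer_extend_castSucc (q : Fin c) :
    (Y.extend g k hdk hkd).stabKer q.castSucc = (Y.stabKer q).map (Y.inl₁ n₁) := by
  unfold stabKer
  rw [Fin.succ_castSucc, FilteredFreeModule.fil_extend_castSucc,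
    FilteredFreeModule.fil_extend_castSucc, FilteredFreeModule.fil_extend_castSucc,
    prevIdeal_castSucc, h_extend_castSucc, ← Submodule.map_smul'', ← Submodule.map_comp,
    Submodule.map_sup, Submodule.map_sup, ← Submodule.map_comp]
  rfl

theorem stabKer_extend_last :
    (Y.extend g k hdk hkd).stabKer (Fin.last c) =
      LinearMap.range (Y.inl₁ n₁) ⊔ seqIdeal (dropLast f) • ⊤ ⊔
        LinearMap.range (k ∘ₗ Y.inl₀ n₀) := by
  unfold stabKer
  rw [Fin.succ_last, FilteredFreeModule.fil_extend_last, FilteredFreeModule.fil_extend_castSucc,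
    FilteredFreeModule.fil_extend_castSucc, prevIdeal_last, h_extend_last, Y.A₁.fil_last,
    Y.A₀.fil_last, Submodule.map_top, Submodule.map_top, LinearMap.range_comp]

theorem preStableAt_extend_castSucc {q : Fin c} (h : Y.PreStableAt q) :
    (Y.extend g k hdk hkd).PreStableAt q.castSucc := by
  intro x hx hfx
  rw [stabKer_extend_castSucc] at hfx ⊢
  rw [Fin.succ_castSucc, FilteredFreeModule.fil_extend_castSucc] at hx
  obtain ⟨y, hy, rfl⟩ := hx
  rw [← map_smul] at hfx
  refine ⟨y, h y hy ?_, rfl⟩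
  obtain ⟨z, hz, hzy⟩ := hfx
  exact LinearMap.inl_injective (R := S) hzy ▸ hz

theorem stableAt_extend_castSucc {q : Fin c} (h : Y.StableAt q) :
    (Y.extend g k hdk hkd).StableAt q.castSucc :=
  IsMCMOver.quotient_map (j := Y.inl₁ n₁) LinearMap.inl_injective (prevIdeal_castSucc f q)
    (by rw [Fin.succ_castSucc, FilteredFreeModule.fil_extend_castSucc])
    (Y.stabKer_extend_castSucc g k hdk hkd q) h

/-- The condition on `Φ` embeds the last module C_p in `N`, and regularity passes to submodules. -/
theorem preStableAt_extend_last {N : Type*} [AddCommGroup N] [Module S N]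
    {Φ : Y.A₁.carrier × (Fin n₁ → S) →ₗ[S] N}
    (hΦ : LinearMap.ker Φ = LinearMap.range (Y.inl₁ n₁) ⊔ seqIdeal (dropLast f) • ⊤ ⊔
      LinearMap.range (k ∘ₗ Y.inl₀ n₀)) (hN : IsSMulRegular N (f (Fin.last c))) :
    (Y.extend g k hdk hkd).PreStableAt (Fin.last c) := by
  intro x _ hfx
  rw [stabKer_extend_last, ← hΦ, LinearMap.mem_ker] at hfx ⊢
  rw [map_smul] at hfx
  exact hN (hfx.trans (smul_zero _).symm)

theorem stableAt_extend_last {N : Type u} [AddCommGroup N] [Module S N]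
    {Φ : Y.A₁.carrier × (Fin n₁ → S) →ₗ[S] N}
    (hΦ : LinearMap.ker Φ = LinearMap.range (Y.inl₁ n₁) ⊔ seqIdeal (dropLast f) • ⊤ ⊔
      LinearMap.range (k ∘ₗ Y.inl₀ n₀)) (hΦ' : Function.Surjective Φ)
    (hN : IsMCMOver (seqIdeal (dropLast f)) N) :
    (Y.extend g k hdk hkd).StableAt (Fin.last c) := by
  unfold StableAt
  rw [prevIdeal_last, Fin.succ_last, FilteredFreeModule.fil_extend_last, stabKer_extend_last, ← hΦ]
  refine hN.congr (LinearEquiv.symm ?_)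
  refine (Submodule.Quotient.equiv _ (LinearMap.ker Φ) Submodule.topEquiv ?_).trans
    (Φ.quotKerEquivOfSurjective hΦ')
  ext x
  exact ⟨fun ⟨y, hy, hyx⟩ ↦ hyx ▸ hy, fun hx ↦ ⟨⟨x, trivial⟩, hx, rfl⟩⟩

theorem mem_extendFil_castSucc_succ {A : FilteredFreeModule S c} {n : ℕ} {q : Fin c}
    {x : A.carrier × (Fin n → S)} :
    x ∈ (A.extend n).fil q.castSucc.succ ↔ x.1 ∈ A.fil q.succ ∧ x.2 = 0 := by
  rw [Fin.succ_castSucc, FilteredFreeModule.fil_extend_castSucc]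
  constructor
  · rintro ⟨y, hy, rfl⟩
    exact ⟨hy, rfl⟩
  · rintro ⟨h1, h2⟩
    exact ⟨x.1, h1, Prod.ext rfl h2.symm⟩

/-- The last step of A₀ is everything and the earlier ones are the old steps, so the new source is
the old source plus A₀, and the new total map is the old one next to `k`. This is the S-level form
of F₄ = G₂ ⊕ F₂. -/
theorem exists_source_equiv :
    ∃ e : (∀ p : Fin (c + 1), (Y.A₀.extend n₀).fil p.succ) ≃ₗ[S]
      (∀ q : Fin c, Y.A₀.fil q.succ) × (Y.A₀.carrier × (Fin n₀ → S)),
      ∀ x, (Y.extend g k hdk hkd).hTotal x = Y.inl₁ n₁ (Y.hTotal (e x).1) + k (e x).2 := by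
  let E : (∀ p : Fin (c + 1), (Y.A₀.extend n₀).fil p.succ) →ₗ[S]
      (∀ q : Fin c, Y.A₀.fil q.succ) × (Y.A₀.carrier × (Fin n₀ → S)) :=
    { toFun := fun x ↦ (fun q ↦ ⟨(x q.castSucc).1.1,
        (mem_extendFil_castSucc_succ.1 (x q.castSucc).2).1⟩, (x (Fin.last c)).1)
      map_add' := fun _ _ ↦ rfl
      map_smul' := fun _ _ ↦ rfl }
  have hE : Function.Bijective E := by
    constructor
    · intro x y hxy
      have h1 : ∀ q : Fin c, (x q.castSucc).1.1 = (y q.castSucc).1.1 := fun q ↦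
        congrArg Subtype.val (congrFun (congrArg Prod.fst hxy) q)
      have h2 : (x (Fin.last c)).1 = (y (Fin.last c)).1 := congrArg Prod.snd hxy
      funext p
      induction p using Fin.lastCases with
      | last => exact Subtype.ext h2
      | cast q =>
        refine Subtype.ext (Prod.ext (h1 q) ?_)
        rw [(mem_extendFil_castSucc_succ.1 (x q.castSucc).2).2,
          (mem_extendFil_castSucc_succ.1 (y q.castSucc).2).2]
    · rintro ⟨y, a⟩
      refine ⟨fun p ↦ Fin.lastCases (motive := fun p ↦ (Y.A₀.extend n₀).fil p.succ)
        ⟨a, by rw [Fin.succ_last, FilteredFreeModule.fil_extend_last]; trivial⟩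
        (fun q ↦ ⟨(y q, 0), mem_extendFil_castSucc_succ.2 ⟨(y q).2, rfl⟩⟩) p, ?_⟩
      refine Prod.ext (funext fun q ↦ Subtype.ext ?_) ?_
      · simp [E]
      · simp [E]
  refine ⟨LinearEquiv.ofBijective E hE, fun x ↦ ?_⟩
  rw [hTotal_apply, Fin.sum_univ_castSucc, hTotal_apply, map_sum]
  simp only [extendH_castSucc, extendH_last]
  rfl

end

end AmbientHMF

/-! ### The lifted resolution and the complex of kernels of the CI operator -/

theorem mulVecLin_mem_ideal_smul_top {R : Type*} [CommRing R] {I : Ideal R} {a b : ℕ}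
    {A : Matrix (Fin b) (Fin a) R} (hA : ∀ k l, A k l ∈ I) (x : Fin a → R) :
    A.mulVecLin x ∈ I • (⊤ : Submodule R (Fin b → R)) := by
  refine mem_smul_top_pi fun k ↦ ?_
  rw [smul_eq_mul, Ideal.mul_top]
  change ∑ l, A k l * x l ∈ I
  exact sum_mem fun l _ ↦ Ideal.mul_mem_right _ _ (hA k l)

/-- A lifting to `S ⧸ J` of a minimal resolution over `S ⧸ (J, r)`, with surjective maps `t` such
that the square of the differential is `r • t`. -/
structure CISystem {S : Type u} [CommRing S] (J 𝔪 : Ideal S) (r : S) where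
  rank : ℕ → ℕ
  D : ∀ i, Matrix (Fin (rank i)) (Fin (rank (i + 1))) (S ⧸ J)
  t : ∀ i, Matrix (Fin (rank i)) (Fin (rank (i + 2))) (S ⧸ J)
  sq : ∀ i x, (D i).mulVecLin ((D (i + 1)).mulVecLin x) = r • (t i).mulVecLin x
  t_surjective : ∀ i, Function.Surjective (t i).mulVecLin
  exact_mod : ∀ i x, (D i).mulVecLin x = 0 → ∃ y z, x = (D (i + 1)).mulVecLin y + r • z
  minimal : ∀ i k l, D i k l ∈ 𝔪.map (Ideal.Quotient.mk J)
  regular : IsSMulRegular (S ⧸ J) r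

namespace CISystem

variable {S : Type u} [CommRing S] {J 𝔪 : Ideal S} {r : S} (C : CISystem J 𝔪 r)

theorem regular_pi (C : CISystem J 𝔪 r) (n : ℕ) : IsSMulRegular (Fin n → S ⧸ J) r :=
  fun _ _ hxy ↦ funext fun i ↦ C.regular (congrFun hxy i)

/-- Both sides become D³ after multiplication by the regular element `r`. -/
theorem comm (i : ℕ) (x : Fin (C.rank (i + 3)) → S ⧸ J) :
    (C.D i).mulVecLin ((C.t (i + 1)).mulVecLin x) =
      (C.t i).mulVecLin ((C.D (i + 2)).mulVecLin x) := by
  apply C.regular_pi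
  change r • _ = r • _
  rw [← C.sq, ← LinearMap.map_smul_of_tower, ← C.sq]

/-- Write `x = D y + r z` and `z = t v`; then `r z = D² v` is absorbed by replacing `y` with `y + D
v`. The new preimage satisfies `r t y = D² y = D x = 0`, so it lies in Ker t. This makes the kernels
of `t` a resolution. -/
theorem exact (i : ℕ) {x : Fin (C.rank (i + 1)) → S ⧸ J} (hx : (C.D i).mulVecLin x = 0) :
    ∃ y, (C.D (i + 1)).mulVecLin y = x ∧ (C.t i).mulVecLin y = 0 := by
  obtain ⟨y, z, h⟩ := C.exact_mod i x hx
  obtain ⟨v, rfl⟩ := C.t_surjective (i + 1) z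
  have h' : (C.D (i + 1)).mulVecLin (y + (C.D (i + 2)).mulVecLin v) = x := by
    rw [map_add, C.sq, h]
  refine ⟨_, h', C.regular_pi _ ?_⟩
  change r • _ = r • _
  rw [← C.sq, h', hx, smul_zero]

/-- Writing `x = t v` gives `r x = D² v`. Hence the cokernel of `D 0` is already a module over the
quotient by `r`. -/
theorem smul_mem_range (x : Fin (C.rank 0) → S ⧸ J) :
    r • x ∈ LinearMap.range (C.D 0).mulVecLin := by
  obtain ⟨v, rfl⟩ := C.t_surjective 0 x
  exact ⟨_, C.sq 0 v⟩

theorem exists_section (i : ℕ) : ∃ s : (Fin (C.rank i) → S ⧸ J) →ₗ[S ⧸ J]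
    (Fin (C.rank (i + 2)) → S ⧸ J), ∀ x, (C.t i).mulVecLin (s x) = x := by
  obtain ⟨s, hs⟩ := Module.projective_lifting_property (C.t i).mulVecLin LinearMap.id
    (C.t_surjective i)
  exact ⟨s, fun x ↦ LinearMap.congr_fun hs x⟩

/-- The kernel of `t`. -/
abbrev G (i : ℕ) : Submodule (S ⧸ J) (Fin (C.rank (i + 2)) → S ⧸ J) :=
  LinearMap.ker (C.t i).mulVecLin

theorem exists_retraction (i : ℕ) : ∃ p : (Fin (C.rank (i + 2)) → S ⧸ J) →ₗ[S ⧸ J] C.G i,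
    p ∘ₗ (C.G i).subtype = LinearMap.id := by
  obtain ⟨s, hs⟩ := C.exists_section i
  refine ⟨LinearMap.codRestrict (C.G i) (LinearMap.id - s ∘ₗ (C.t i).mulVecLin) fun x ↦ ?_, ?_⟩
  · rw [LinearMap.mem_ker, LinearMap.sub_apply, map_sub, LinearMap.comp_apply, hs,
      LinearMap.id_apply, sub_self]
  · refine LinearMap.ext fun x ↦ Subtype.ext ?_
    have : (C.t i).mulVecLin x = 0 := x.2
    rw [LinearMap.comp_apply, LinearMap.codRestrict_apply, LinearMap.sub_apply,
      LinearMap.comp_apply, Submodule.subtype_apply, this, map_zero, sub_zero]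
    rfl

theorem projective_G (i : ℕ) : Module.Projective (S ⧸ J) (C.G i) := by
  obtain ⟨p, hp⟩ := C.exists_retraction i
  exact Module.Projective.of_split _ p hp

theorem finite_G (i : ℕ) : Module.Finite (S ⧸ J) (C.G i) := by
  obtain ⟨p, hp⟩ := C.exists_retraction i
  exact Module.Finite.of_surjective p fun x ↦ ⟨x, LinearMap.congr_fun hp x⟩

/-- Ker t is a direct summand, so minimality of `D` restricts to it. -/
theorem mem_smul_top_G {i : ℕ} {x : C.G i} {I : Ideal (S ⧸ J)}
    (hx : (x : Fin (C.rank (i + 2)) → S ⧸ J) ∈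
      I • (⊤ : Submodule (S ⧸ J) (Fin (C.rank (i + 2)) → S ⧸ J))) :
    x ∈ I • (⊤ : Submodule (S ⧸ J) (C.G i)) := by
  obtain ⟨p, hp⟩ := C.exists_retraction i
  have := Submodule.mem_map_of_mem (f := p) hx
  rw [Submodule.map_smul''] at this
  have hpx : p x = x := LinearMap.congr_fun hp x
  rw [hpx] at this
  exact Submodule.smul_mono le_rfl le_top this

theorem D_mem_smul_top (i : ℕ) (x : Fin (C.rank (i + 1)) → S ⧸ J) :
    (C.D i).mulVecLin x ∈ 𝔪.map (Ideal.Quotient.mk J) •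
      (⊤ : Submodule (S ⧸ J) (Fin (C.rank i) → S ⧸ J)) :=
  mulVecLin_mem_ideal_smul_top (C.minimal i) x

/-- The differential on the kernels of `t`. -/
abbrev dG (i : ℕ) : C.G (i + 1) →ₗ[S ⧸ J] C.G i :=
  (C.D (i + 2)).mulVecLin.restrict fun x hx ↦ by
    rw [LinearMap.mem_ker] at hx ⊢
    rw [← C.comm, hx, map_zero]

/-- The augmentation of the resolution by the kernels of `t`. -/
abbrev aug : C.G 0 →ₗ[S ⧸ J] LinearMap.ker (C.D 0).mulVecLin :=
  (C.D 1).mulVecLin.restrict fun x hx ↦ by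
    rw [LinearMap.mem_ker] at hx ⊢
    rw [C.sq, hx, smul_zero]

/-- A cycle of `D` has a preimage inside Ker t by `exact`; the same argument gives exactness of the
kernel complex in all degrees. -/
theorem aug_surjective : Function.Surjective C.aug := by
  rintro ⟨x, hx⟩
  obtain ⟨y, hy, hy'⟩ := C.exact 0 hx
  exact ⟨⟨y, hy'⟩, Subtype.ext hy⟩

theorem ker_aug : LinearMap.ker C.aug = LinearMap.range (C.dG 0) := by
  ext ⟨x, hx⟩
  have hx' : (C.t 0).mulVecLin x = 0 := hx
  constructor
  · intro h
    have h' : (C.D 1).mulVecLin x = 0 := congrArg Subtype.val h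
    obtain ⟨y, hy, hy'⟩ := C.exact 1 h'
    exact ⟨⟨y, hy'⟩, Subtype.ext hy⟩
  · rintro ⟨⟨y, hy⟩, hyx⟩
    have hy' : (C.t 1).mulVecLin y = 0 := hy
    have h' : (C.D 2).mulVecLin y = x := congrArg Subtype.val hyx
    refine Subtype.ext ?_
    change (C.D 1).mulVecLin x = 0
    rw [← h', C.sq, hy', smul_zero]

theorem ker_dG (i : ℕ) : LinearMap.ker (C.dG i) = LinearMap.range (C.dG (i + 1)) := by
  ext ⟨x, hx⟩
  constructor
  · intro h
    have h' : (C.D (i + 2)).mulVecLin x = 0 := congrArg Subtype.val h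
    obtain ⟨y, hy, hy'⟩ := C.exact (i + 2) h'
    exact ⟨⟨y, hy'⟩, Subtype.ext hy⟩
  · rintro ⟨⟨y, hy⟩, hyx⟩
    have hy' : (C.t (i + 2)).mulVecLin y = 0 := hy
    have h' : (C.D (i + 3)).mulVecLin y = x := congrArg Subtype.val hyx
    refine Subtype.ext ?_
    change (C.D (i + 2)).mulVecLin x = 0
    rw [← h', C.sq, hy', smul_zero]

theorem range_dG_le (i : ℕ) :
    LinearMap.range (C.dG i) ≤ 𝔪.map (Ideal.Quotient.mk J) • ⊤ := by
  rintro _ ⟨x, rfl⟩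
  exact C.mem_smul_top_G (C.D_mem_smul_top (i + 2) x)

end CISystem

/-- The units `x * y + 1` of `S` map to units. No properness of `J` is required, although for `J =
⊤` the quotient is not local. -/
theorem map_mk_le_jacobson {S : Type*} [CommRing S] [IsLocalRing S] (J : Ideal S) :
    (IsLocalRing.maximalIdeal S).map (Ideal.Quotient.mk J) ≤ Ideal.jacobson ⊥ := by
  rw [Ideal.map_le_iff_le_comap]
  intro x hx
  rw [Ideal.mem_comap, Ideal.mem_jacobson_bot]
  intro y
  obtain ⟨y, rfl⟩ := Ideal.Quotient.mk_surjective y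
  have : IsUnit (x * y + 1) := by
    have hxy : x * y ∈ Ideal.jacobson (⊥ : Ideal S) := by
      rw [IsLocalRing.jacobson_eq_maximalIdeal _ bot_ne_top]
      exact Ideal.mul_mem_right _ _ hx
    simpa using Ideal.mem_jacobson_bot.1 hxy 1
  simpa using this.map (Ideal.Quotient.mk J)

theorem MinimalFreeResolution.range_le {S : Type u} [CommRing S] [IsLocalRing S] {I : Ideal S}
    (F : MinimalFreeResolution I) (i : ℕ) :
    LinearMap.range (F.δ i).mulVecLin ≤
      (IsLocalRing.maximalIdeal S).map (Ideal.Quotient.mk I) • ⊤ := by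
  rintro _ ⟨x, rfl⟩
  exact mulVecLin_mem_ideal_smul_top (F.minimal i) x

theorem MinimalFreeResolution.ker_eq {S : Type u} [CommRing S] [IsLocalRing S] {I : Ideal S}
    (F : MinimalFreeResolution I) (i : ℕ) :
    LinearMap.ker (F.δ i).mulVecLin = LinearMap.range (F.δ (i + 1)).mulVecLin :=
  (F.exact i).linearMap_ker_eq

namespace CISystem

variable {S : Type u} [CommRing S] [IsLocalRing S] {J : Ideal S} {r : S}
  (C : CISystem J (IsLocalRing.maximalIdeal S) r)

/-- The kernels of `t` form the minimal resolution of `Ker (D 0)`, in the first three degrees. -/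
theorem exists_equiv_resolution (F : MinimalFreeResolution J)
    (e : F.resolved ≃ₗ[S ⧸ J] LinearMap.ker (C.D 0).mulVecLin) :
    ∃ (u₀ : (Fin (F.rank 0) → S ⧸ J) ≃ₗ[S ⧸ J] C.G 0)
      (u₁ : (Fin (F.rank 1) → S ⧸ J) ≃ₗ[S ⧸ J] C.G 1)
      (u₂ : (Fin (F.rank 2) → S ⧸ J) ≃ₗ[S ⧸ J] C.G 2),
      (∀ x, C.dG 0 (u₁ x) = u₀ ((F.δ 0).mulVecLin x)) ∧
      ∀ x, C.dG 1 (u₂ x) = u₁ ((F.δ 1).mulVecLin x) := by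
  have hm := map_mk_le_jacobson J
  have := C.projective_G
  have := C.finite_G
  obtain ⟨u₀, h₀⟩ := exists_equiv_of_minimal_cover hm
    (p := (LinearMap.range (F.δ 0).mulVecLin).mkQ) (Submodule.mkQ_surjective _) C.aug_surjective
    (by rw [Submodule.ker_mkQ]; exact F.range_le 0) (by rw [C.ker_aug]; exact C.range_dG_le 0) e
  obtain ⟨u₁, h₁⟩ := exists_equiv_of_minimal_cover_range hm
    (p := (F.δ 0).mulVecLin) (q := C.dG 0) (by rw [F.ker_eq]; exact F.range_le 1)
    (by rw [C.ker_dG]; exact C.range_dG_le 1) u₀ (by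
      rw [← C.ker_aug, ← map_ker_eq_of_comm (φ := e.toLinearMap) e.injective h₀, Submodule.ker_mkQ])
  obtain ⟨u₂, h₂⟩ := exists_equiv_of_minimal_cover_range hm
    (p := (F.δ 1).mulVecLin) (q := C.dG 1) (by rw [F.ker_eq]; exact F.range_le 2)
    (by rw [C.ker_dG]; exact C.range_dG_le 2) u₁ (by
      rw [← C.ker_dG, ← map_ker_eq_of_comm (φ := u₀.toLinearMap) u₀.injective h₁, F.ker_eq])
  exact ⟨u₀, u₁, u₂, h₁, h₂⟩

end CISystem

namespace CISystem

variable {S : Type u} [CommRing S] {J 𝔪 : Ideal S} {r : S} (C : CISystem J 𝔪 r)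

/-- A reduction of `Ker t`, as a map to the source of `t`. -/
def intoSource {i n : ℕ} (u : (Fin n → S ⧸ J) ≃ₗ[S ⧸ J] C.G i) {A : Type*} [AddCommGroup A]
    [Module S A] (ρ : A →ₗ[S] (Fin n → S ⧸ J)) : A →ₗ[S] (Fin (C.rank (i + 2)) → S ⧸ J) :=
  ((C.G i).subtype ∘ₗ u.toLinearMap).restrictScalars S ∘ₗ ρ

theorem range_intoSource {i n : ℕ} (u : (Fin n → S ⧸ J) ≃ₗ[S ⧸ J] C.G i) {A : Type*}
    [AddCommGroup A] [Module S A] {ρ : A →ₗ[S] (Fin n → S ⧸ J)} (hρ : IsReduction J ρ) :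
    LinearMap.range (C.intoSource u ρ) = LinearMap.ker ((C.t i).mulVecLin.restrictScalars S) := by
  ext x
  constructor
  · rintro ⟨a, rfl⟩
    exact (u (ρ a)).2
  · intro hx
    obtain ⟨y, hy⟩ := u.surjective ⟨x, hx⟩
    obtain ⟨a, rfl⟩ := hρ.surjective y
    exact ⟨a, congrArg Subtype.val hy⟩

theorem ker_intoSource {i n : ℕ} (u : (Fin n → S ⧸ J) ≃ₗ[S ⧸ J] C.G i) {A : Type*}
    [AddCommGroup A] [Module S A] {ρ : A →ₗ[S] (Fin n → S ⧸ J)} (hρ : IsReduction J ρ) :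
    LinearMap.ker (C.intoSource u ρ) = J • ⊤ := by
  ext x
  rw [← hρ.eq_zero_iff, LinearMap.mem_ker, ← u.map_eq_zero_iff]
  exact Submodule.coe_eq_zero

end CISystem

/-! ### The inductive construction -/

/-- The extension of a higher matrix factorization that reduces to the minimal resolution of
`Ker (D 0)`. -/
theorem exists_extension {S : Type u} [CommRing S] [IsLocalRing S] {c : ℕ} {f : Fin (c + 1) → S}
    (C : CISystem (seqIdeal (dropLast f)) (IsLocalRing.maximalIdeal S) (f (Fin.last c)))
    (Y : AmbientHMF (dropLast f)) (F : MinimalFreeResolution (seqIdeal (dropLast f)))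
    (hY : Y.ReducesTo F)
    (e : F.resolved ≃ₗ[S ⧸ seqIdeal (dropLast f)] LinearMap.ker (C.D 0).mulVecLin) :
    ∃ Z : AmbientHMF f,
      (∃ (ρ₀ : Z.A₀.carrier →ₗ[S] (Fin (C.rank 2) → S ⧸ seqIdeal (dropLast f)))
        (ρ₁ : Z.A₁.carrier →ₗ[S] (Fin (C.rank 3) → S ⧸ seqIdeal (dropLast f)))
        (ρ₂ : (∀ p : Fin (c + 1), Z.A₀.fil p.succ) →ₗ[S]
          (Fin (C.rank 4) → S ⧸ seqIdeal (dropLast f))),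
        IsReduction (seqIdeal (dropLast f)) ρ₀ ∧ IsReduction (seqIdeal (dropLast f)) ρ₁ ∧
        IsReduction (seqIdeal (dropLast f)) ρ₂ ∧
        (∀ x, ρ₀ (Z.d x) = (C.D 2).mulVecLin (ρ₁ x)) ∧
        ∀ x, ρ₁ (Z.hTotal x) = (C.D 3).mulVecLin (ρ₂ x)) ∧
      ((∀ q, Y.PreStableAt q) → ∀ p, Z.PreStableAt p) ∧
      (IsMCMOver (seqIdeal (dropLast f)) (LinearMap.range (C.D 0).mulVecLin) →
        (∀ q, Y.StableAt q) → ∀ p, Z.StableAt p) := by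
  obtain ⟨ρF₀, ρF₁, ρF₂, hF₀, hF₁, hF₂, hFd, hFh⟩ := hY
  obtain ⟨u₀, u₁, u₂, hu₁, hu₂⟩ := C.exists_equiv_resolution F e
  obtain ⟨s₀, hs₀⟩ := C.exists_section 0
  obtain ⟨s₁, hs₁⟩ := C.exists_section 1
  obtain ⟨s₂, hs₂⟩ := C.exists_section 2
  have := Y.A₀.free_carrier
  have := Y.A₁.free_carrier
  set ρ'₀ := C.intoSource u₀ ρF₀ with hρ'₀
  set ρ'₁ := C.intoSource u₁ ρF₁ with hρ'₁
  set ρ'₂ := C.intoSource u₂ ρF₂ with hρ'₂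
  have hd' : ∀ x, ρ'₀ (Y.d x) = (C.D 2).mulVecLin (ρ'₁ x) := fun x ↦ by
    have h := congrArg Subtype.val (hu₁ (ρF₁ x))
    rw [← hFd] at h
    exact h.symm
  have hh' : ∀ x, ρ'₁ (Y.hTotal x) = (C.D 3).mulVecLin (ρ'₂ x) := fun x ↦ by
    have h := congrArg Subtype.val (hu₂ (ρF₂ x))
    rw [← hFh] at h
    exact h.symm
  have ht₁ : ∀ x, (C.t 1).mulVecLin (ρ'₁ x) = 0 := fun x ↦ (u₁ (ρF₁ x)).2
  have ht₀ : ∀ x, (C.t 0).mulVecLin (ρ'₀ x) = 0 := fun x ↦ (u₀ (ρF₀ x)).2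
  -- The splittings F₂ = Ker t ⊕ s(F₀) and F₃ = Ker t ⊕ s(F₁): the old module reduces to the kernel
  -- and the new free factor to the image of the section.
  set ρ₀ := ρ'₀.coprod (s₀.restrictScalars S ∘ₗ quotPi (seqIdeal (dropLast f)) (C.rank 0)) with hρ₀
  set ρ₁ := ρ'₁.coprod (s₁.restrictScalars S ∘ₗ quotPi (seqIdeal (dropLast f)) (C.rank 1)) with hρ₁
  have hr₀ : IsReduction (seqIdeal (dropLast f)) ρ₀ := IsReduction.coprod (t := (C.t 0).mulVecLin.restrictScalars S)
    hs₀ (C.range_intoSource u₀ hF₀) (C.ker_intoSource u₀ hF₀) (isReduction_quotPi (seqIdeal (dropLast f)) _)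
  have hr₁ : IsReduction (seqIdeal (dropLast f)) ρ₁ := IsReduction.coprod (t := (C.t 1).mulVecLin.restrictScalars S)
    hs₁ (C.range_intoSource u₁ hF₁) (C.ker_intoSource u₁ hF₁) (isReduction_quotPi (seqIdeal (dropLast f)) _)
  -- On the old summand `d` already lifts D; `g` lifts D on the complement s(F₁).
  obtain ⟨g, hg⟩ := Module.projective_lifting_property ρ₀
    (((C.D 2).mulVecLin ∘ₗ s₁).restrictScalars S ∘ₗ quotPi (seqIdeal (dropLast f)) (C.rank 1)) hr₀.surjective
  -- The new homotopy lifts F₂ → F₄ → F₃, the section followed by the differential.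
  obtain ⟨k, hk⟩ := Module.projective_lifting_property ρ₁
    (((C.D 3).mulVecLin ∘ₗ s₂).restrictScalars S ∘ₗ ρ₀) hr₁.surjective
  have hg' : ∀ x, ρ₀ (g x) = (C.D 2).mulVecLin (s₁ (quotPi (seqIdeal (dropLast f)) _ x)) := LinearMap.congr_fun hg
  have hk' : ∀ x, ρ₁ (k x) = (C.D 3).mulVecLin (s₂ (ρ₀ x)) := LinearMap.congr_fun hk
  have hinl₀ : ∀ x, ρ₀ (Y.inl₀ _ x) = ρ'₀ x := fun x ↦ by simp [hρ₀]
  have hinl₁ : ∀ x, ρ₁ (Y.inl₁ _ x) = ρ'₁ x := fun x ↦ by simp [hρ₁]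
  have hρd : ∀ x, ρ₀ (Y.extendD g x) = (C.D 2).mulVecLin (ρ₁ x) := by
    rintro ⟨x, y⟩
    have h1 : Y.extendD g (x, y) = Y.inl₀ _ (Y.d x) + g y := by simp
    have h2 : ρ₁ (x, y) = ρ'₁ x + s₁ (quotPi (seqIdeal (dropLast f)) _ y) := by simp [hρ₁]
    rw [h1, h2, map_add, map_add, hg', hinl₀, hd']
  -- After reduction: D D s = r t s = r.
  have hdk : ∀ x, Y.extendD g (k x) - f (Fin.last c) • x ∈ (seqIdeal (dropLast f)) • (⊤ : Submodule S _) := fun x ↦ by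
    rw [← hr₀.eq_zero_iff, map_sub, hρd, hk', C.sq, hs₂, map_smul, sub_self]
  -- Modulo the ideal, `t 1` plays the role of the projection of A₁ onto its quotient by the old
  -- part.
  have hmem : ∀ z, (C.t 1).mulVecLin (ρ₁ z) = 0 →
      z ∈ LinearMap.range (Y.inl₁ (C.rank 1)) ⊔ (seqIdeal (dropLast f)) • (⊤ : Submodule S _) := fun z hz ↦ by
    have hz' : ρ₁ z ∈ LinearMap.ker ((C.t 1).mulVecLin.restrictScalars S) := hz
    rw [← C.range_intoSource u₁ hF₁] at hz'
    obtain ⟨a, ha⟩ := hz'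
    refine Submodule.mem_sup.2 ⟨_, ⟨a, rfl⟩, z - Y.inl₁ _ a, ?_, add_sub_cancel _ _⟩
    rw [← hr₁.eq_zero_iff, map_sub, hinl₁, sub_eq_zero]
    exact ha.symm
  -- After applying `t 1`: t D s D = D t s D = D² = r t.
  have hkd : ∀ x, k (Y.extendD g x) - f (Fin.last c) • x ∈
      LinearMap.range (Y.inl₁ (C.rank 1)) ⊔ (seqIdeal (dropLast f)) • (⊤ : Submodule S _) := fun x ↦ by
    apply hmem
    rw [map_sub, hk', hρd, map_smul, map_sub, ← C.comm, hs₂, C.sq, LinearMap.map_smul_of_tower,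
      sub_self]
  -- `Φ` identifies the last module C_p with the image of D : F₁ → F₀. Through `t 1` the quotient of
  -- A₁ becomes F₁, the restriction of `k` to the old A₀ becomes D : G₀ → F₁ (`hkt`), and D(G₀) is
  -- all of Ker(F₁ → F₀).
  let Φ : Y.A₁.carrier × (Fin (C.rank 1) → S) →ₗ[S] LinearMap.range (C.D 0).mulVecLin :=
    ((C.D 0).mulVecLin.rangeRestrict ∘ₗ (C.t 1).mulVecLin).restrictScalars S ∘ₗ ρ₁
  have hΦ : LinearMap.ker Φ = LinearMap.range (Y.inl₁ (C.rank 1)) ⊔ (seqIdeal (dropLast f)) • ⊤ ⊔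
      LinearMap.range (k ∘ₗ Y.inl₀ (C.rank 0)) := by
    have hΦ₀ : ∀ z, z ∈ LinearMap.ker Φ ↔ (C.D 0).mulVecLin ((C.t 1).mulVecLin (ρ₁ z)) = 0 :=
      fun z ↦ Submodule.coe_eq_zero.symm
    have hkt : ∀ a, (C.t 1).mulVecLin (ρ₁ (k (Y.inl₀ _ a))) = (C.D 1).mulVecLin (ρ'₀ a) :=
      fun a ↦ by rw [hk', ← C.comm, hs₂, hinl₀]
    apply le_antisymm
    · intro z hz
      obtain ⟨y, hy, hy'⟩ := C.exact 0 ((hΦ₀ z).1 hz)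
      have hy'' : y ∈ LinearMap.ker ((C.t 0).mulVecLin.restrictScalars S) := hy'
      rw [← C.range_intoSource u₀ hF₀] at hy''
      obtain ⟨a, rfl⟩ := hy''
      refine Submodule.mem_sup.2 ⟨z - k (Y.inl₀ _ a), hmem _ ?_, _, ⟨a, rfl⟩, sub_add_cancel _ _⟩
      rw [map_sub, map_sub, hkt, sub_eq_zero]
      exact hy.symm
    · refine sup_le (sup_le ?_ ?_) ?_
      · rintro _ ⟨a, rfl⟩
        rw [hΦ₀, hinl₁, ht₁, map_zero]
      · intro z hz
        rw [hΦ₀, hr₁.eq_zero_iff.2 hz, map_zero, map_zero]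
      · rintro _ ⟨a, rfl⟩
        rw [hΦ₀, LinearMap.comp_apply, hkt, C.sq, ht₀, smul_zero]
  have hΦ' : Function.Surjective Φ :=
    ((C.D 0).mulVecLin.surjective_rangeRestrict.comp (C.t_surjective 1)).comp hr₁.surjective
  obtain ⟨ε, hε⟩ := Y.exists_source_equiv g k hdk hkd
  refine ⟨Y.extend g k hdk hkd, ⟨ρ₀, ρ₁,
    (ρ'₂.coprod (s₂.restrictScalars S ∘ₗ ρ₀)) ∘ₗ ε.toLinearMap, hr₀, hr₁, ?_, hρd, ?_⟩, ?_, ?_⟩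
  -- The third splitting, F₄ = Ker t ⊕ s(F₂), where the complement is covered by the whole new A₀.
  · exact IsReduction.comp_equiv (IsReduction.coprod (t := (C.t 2).mulVecLin.restrictScalars S)
      hs₂ (C.range_intoSource u₂ hF₂) (C.ker_intoSource u₂ hF₂) hr₀) ε
  · intro x
    have h1 : (ρ'₂.coprod (s₂.restrictScalars S ∘ₗ ρ₀) ∘ₗ ε.toLinearMap) x =
        ρ'₂ (ε x).1 + s₂ (ρ₀ (ε x).2) := by simp
    rw [h1, hε, map_add, map_add, hinl₁, hh', hk']
  · intro h p
    induction p using Fin.lastCases with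
    | last =>
      refine Y.preStableAt_extend_last g k hdk hkd hΦ fun x y hxy ↦ Subtype.ext ?_
      exact C.regular_pi _ (congrArg Subtype.val hxy)
    | cast q => exact Y.preStableAt_extend_castSucc g k hdk hkd (h q)
  · intro hN h p
    induction p using Fin.lastCases with
    | last => exact Y.stableAt_extend_last g k hdk hkd hΦ hΦ' hN
    | cast q => exact Y.stableAt_extend_castSucc g k hdk hkd (h q)

/-! ### Splitting off the last member of the regular sequence -/

theorem ofFn_eq_append {S : Type u} {c : ℕ} (f : Fin (c + 1) → S) :
    List.ofFn f = List.ofFn (dropLast f) ++ [f (Fin.last c)] := by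
  rw [List.ofFn_succ', List.concat_eq_append]

section Regular

variable {S : Type u} [CommRing S]

theorem ofList_ofFn {c : ℕ} (f : Fin c → S) : Ideal.ofList (List.ofFn f) = seqIdeal f := by
  unfold Ideal.ofList seqIdeal
  congr 1
  ext x
  exact List.mem_ofFn' f x

theorem seqIdeal_le_maximalIdeal [IsLocalRing S] {c : ℕ} {f : Fin c → S}
    (hf : RingTheory.Sequence.IsRegular S (List.ofFn f)) :
    seqIdeal f ≤ IsLocalRing.maximalIdeal S := by
  rw [Ideal.span_le]
  rintro _ ⟨i, rfl⟩
  exact mem_maximalIdeal_of_isRegular hf _ ((List.mem_ofFn' f _).2 ⟨i, rfl⟩)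

theorem isRegular_dropLast [IsNoetherianRing S] [IsLocalRing S] {c : ℕ} {f : Fin (c + 1) → S}
    (hf : RingTheory.Sequence.IsRegular S (List.ofFn f)) :
    RingTheory.Sequence.IsRegular S (List.ofFn (dropLast f)) := by
  have hmem := mem_maximalIdeal_of_isRegular hf
  have h := hf.toIsWeaklyRegular
  rw [ofFn_eq_append] at h hmem
  rw [IsLocalRing.isRegular_iff_isWeaklyRegular_of_subset_maximalIdeal
    fun r hr ↦ hmem r (List.mem_append_left _ hr)]
  exact ((RingTheory.Sequence.isWeaklyRegular_append_iff S _ _).1 h).1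

theorem isSMulRegular_last {c : ℕ} {f : Fin (c + 1) → S}
    (hf : RingTheory.Sequence.IsRegular S (List.ofFn f)) :
    IsSMulRegular (S ⧸ seqIdeal (dropLast f)) (f (Fin.last c)) := by
  have h := hf.toIsWeaklyRegular
  rw [ofFn_eq_append] at h
  have h' := ((RingTheory.Sequence.isWeaklyRegular_append_iff S _ _).1 h).2
  rw [RingTheory.Sequence.isWeaklyRegular_singleton_iff] at h'
  have e : (Ideal.ofList (List.ofFn (dropLast f)) • ⊤ : Ideal S) = seqIdeal (dropLast f) := by
    rw [ofList_ofFn, smul_eq_mul, Ideal.mul_top]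
  exact ((Submodule.quotEquivOfEq _ _ e).isSMulRegular_congr _).1 h'

end Regular

section QuotFactor

variable {S : Type u} [CommRing S] {c : ℕ} (f : Fin (c + 1) → S)

/-- The coordinatewise reduction from `S ⧸ (f₁, …, f_{c-1})` to `S ⧸ (f₁, …, f_c)`. -/
def factorPi (n : ℕ) : (Fin n → S ⧸ seqIdeal (dropLast f)) →ₗ[S] (Fin n → S ⧸ seqIdeal f) :=
  LinearMap.compLeft (Submodule.factor (seqIdeal_dropLast_le f)) (Fin n)

theorem factorPi_surjective (n : ℕ) : Function.Surjective (factorPi f n) := fun x ↦ by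
  choose y hy using fun i ↦ Submodule.factor_surjective (seqIdeal_dropLast_le f) (x i)
  exact ⟨y, funext hy⟩

theorem exists_eq_smul_of_factorPi_eq_zero {n : ℕ} {x : Fin n → S ⧸ seqIdeal (dropLast f)}
    (hx : factorPi f n x = 0) : ∃ z, x = f (Fin.last c) • z := by
  have h : ∀ i, ∃ z : S ⧸ seqIdeal (dropLast f), x i = f (Fin.last c) • z := by
    intro i
    have hi : Submodule.factor (seqIdeal_dropLast_le f) (x i) = 0 := congrFun hx i
    obtain ⟨s, hs⟩ := Ideal.Quotient.mk_surjective (x i)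
    rw [← hs] at hi ⊢
    have hi' : s ∈ seqIdeal f := (Submodule.Quotient.mk_eq_zero _).1 hi
    rw [seqIdeal_eq_sup] at hi'
    obtain ⟨y, hy, z, hz, rfl⟩ := Submodule.mem_sup.1 hi'
    obtain ⟨w, rfl⟩ := Ideal.mem_span_singleton'.1 hz
    refine ⟨Ideal.Quotient.mk _ w, ?_⟩
    rw [map_add, Ideal.Quotient.eq_zero_iff_mem.2 hy, zero_add, mul_comm]
    rfl
  choose z hz using h
  exact ⟨z, funext hz⟩

theorem smul_last_eq_zero {n : ℕ} (x : Fin n → S ⧸ seqIdeal f) : f (Fin.last c) • x = 0 := by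
  funext i
  obtain ⟨s, hs⟩ := Ideal.Quotient.mk_surjective (x i)
  rw [Pi.smul_apply, ← hs]
  exact Ideal.Quotient.eq_zero_iff_mem.2
    (Ideal.mul_mem_right _ _ (Ideal.subset_span ⟨Fin.last c, rfl⟩))

theorem isReduction_factorPi (n : ℕ) : IsReduction (Ideal.span {f (Fin.last c)}) (factorPi f n) where
  surjective := factorPi_surjective f n
  ker_eq := by
    apply le_antisymm
    · intro x hx
      obtain ⟨z, rfl⟩ := exists_eq_smul_of_factorPi_eq_zero f hx
      exact Submodule.smul_mem_smul (Ideal.mem_span_singleton_self _) trivial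
    · rw [Submodule.ideal_span_singleton_smul]
      rintro _ ⟨x, -, rfl⟩
      rw [LinearMap.mem_ker]
      change factorPi f n (f (Fin.last c) • x) = 0
      rw [map_smul, smul_last_eq_zero]

theorem factorPi_mulVecLin {a b : ℕ} (A : Matrix (Fin b) (Fin a) (S ⧸ seqIdeal (dropLast f)))
    (x : Fin a → S ⧸ seqIdeal (dropLast f)) :
    factorPi f b (A.mulVecLin x) =
      (A.map (Ideal.Quotient.factor (seqIdeal_dropLast_le f))).mulVecLin (factorPi f a x) :=
  funext fun i ↦ RingHom.map_mulVec (Ideal.Quotient.factor (seqIdeal_dropLast_le f)) A x i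

theorem map_factor_map_mk {a b : ℕ} (A : Matrix (Fin b) (Fin a) S) :
    (A.map (Ideal.Quotient.mk (seqIdeal (dropLast f)))).map
      (Ideal.Quotient.factor (seqIdeal_dropLast_le f)) = A.map (Ideal.Quotient.mk (seqIdeal f)) :=
  rfl

end QuotFactor

/-! ### From CI operators to the lifted system -/

namespace CIOperators

variable {S : Type u} [CommRing S] [IsLocalRing S] {c : ℕ} {f : Fin (c + 1) → S}
  {F : MinimalFreeResolution (seqIdeal f)}

/-- Surjectivity is known modulo the last member of the sequence, which lies in the maximal ideal;
Nakayama does the rest. -/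
theorem t_surjective_mod (T : CIOperators f F) (hf : seqIdeal f ≤ IsLocalRing.maximalIdeal S)
    {i : ℕ} (hT : Function.Surjective (T.t (Fin.last c) i).mulVecLin) :
    Function.Surjective
      ((T.t' (Fin.last c) i).map (Ideal.Quotient.mk (seqIdeal (dropLast f)))).mulVecLin := by
  set t := (T.t' (Fin.last c) i).map (Ideal.Quotient.mk (seqIdeal (dropLast f))) with ht
  have hlast : f (Fin.last c) ∈ IsLocalRing.maximalIdeal S := hf (Ideal.subset_span ⟨_, rfl⟩)
  have h : (⊤ : Submodule S (Fin (F.rank i) → S ⧸ seqIdeal (dropLast f))) ≤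
      LinearMap.range (t.mulVecLin.restrictScalars S) := by
    refine Submodule.le_of_le_smul_of_le_jacobson_bot (I := IsLocalRing.maximalIdeal S)
      Module.Finite.fg_top (by rw [IsLocalRing.jacobson_eq_maximalIdeal _ bot_ne_top])
      fun y _ ↦ ?_
    obtain ⟨x, hx⟩ := hT (factorPi f _ y)
    obtain ⟨x, rfl⟩ := factorPi_surjective f _ x
    obtain ⟨z, hz⟩ := exists_eq_smul_of_factorPi_eq_zero f (x := y - t.mulVecLin x) (by
      rw [map_sub, factorPi_mulVecLin, ← hx, sub_eq_zero]; rfl)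
    rw [sub_eq_iff_eq_add'] at hz
    rw [hz]
    exact Submodule.add_mem_sup ⟨x, rfl⟩ (Submodule.smul_mem_smul hlast trivial)
  intro y
  exact h (x := y) trivial

/-- Over the quotient by the earlier members, only the last term of the sum for the squared
differential survives. -/
theorem sq_mod (T : CIOperators f F) (i : ℕ)
    (x : Fin (F.rank (i + 2)) → S ⧸ seqIdeal (dropLast f)) :
    ((T.δ' i).map (Ideal.Quotient.mk (seqIdeal (dropLast f)))).mulVecLin
      (((T.δ' (i + 1)).map (Ideal.Quotient.mk (seqIdeal (dropLast f)))).mulVecLin x) =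
    f (Fin.last c) •
      ((T.t' (Fin.last c) i).map (Ideal.Quotient.mk (seqIdeal (dropLast f)))).mulVecLin x := by
  have h : (T.δ' i).map (Ideal.Quotient.mk (seqIdeal (dropLast f))) *
      (T.δ' (i + 1)).map (Ideal.Quotient.mk (seqIdeal (dropLast f))) =
      f (Fin.last c) • (T.t' (Fin.last c) i).map (Ideal.Quotient.mk (seqIdeal (dropLast f))) := by
    rw [← Matrix.map_mul, T.sq, Fin.sum_univ_castSucc]
    ext k l
    have h0 : ∀ j : Fin c, Ideal.Quotient.mk (seqIdeal (dropLast f)) (f j.castSucc) = 0 :=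
      fun j ↦ Ideal.Quotient.eq_zero_iff_mem.2 (Ideal.subset_span ⟨j, rfl⟩)
    simp only [Matrix.map_apply, Matrix.add_apply, Matrix.sum_apply, Matrix.smul_apply,
      smul_eq_mul, map_add, map_sum, map_mul, h0, zero_mul, Finset.sum_const_zero, zero_add]
    rfl
  rw [Matrix.mulVecLin_apply, Matrix.mulVecLin_apply, Matrix.mulVec_mulVec, h, Matrix.smul_mulVec]
  rfl

/-- The system over `S ⧸ (f₁, …, f_{c-1})` defined by CI operators on a minimal resolution over
`S ⧸ (f₁, …, f_c)`, the last of them surjective. -/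
def toCISystem (T : CIOperators f F) (hf : seqIdeal f ≤ IsLocalRing.maximalIdeal S)
    (hreg : IsSMulRegular (S ⧸ seqIdeal (dropLast f)) (f (Fin.last c)))
    (hT : ∀ i, Function.Surjective (T.t (Fin.last c) i).mulVecLin) :
    CISystem (seqIdeal (dropLast f)) (IsLocalRing.maximalIdeal S) (f (Fin.last c)) where
  rank := F.rank
  D i := (T.δ' i).map (Ideal.Quotient.mk _)
  t i := (T.t' (Fin.last c) i).map (Ideal.Quotient.mk _)
  sq i x := T.sq_mod i x
  t_surjective i := T.t_surjective_mod hf (hT i)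
  -- Exactness of `F` gives a preimage after reduction; the error in lifting it is a multiple of the
  -- last member of the sequence.
  exact_mod i x hx := by
    have h1 : (F.δ i).mulVecLin (factorPi f _ x) = 0 := by
      rw [← T.lifts, ← map_factor_map_mk, ← factorPi_mulVecLin, hx, map_zero]
    obtain ⟨w, hw⟩ := (F.exact i _).1 h1
    obtain ⟨w, rfl⟩ := factorPi_surjective f _ w
    rw [← T.lifts, ← map_factor_map_mk, ← factorPi_mulVecLin, eq_comm, ← sub_eq_zero,
      ← map_sub] at hw
    obtain ⟨z, hz⟩ := exists_eq_smul_of_factorPi_eq_zero f hw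
    exact ⟨w, z, sub_eq_iff_eq_add'.1 hz⟩
  -- The sequence lies in the maximal ideal, so any lifting of an entry from the maximal ideal of
  -- the quotient lies in the maximal ideal of `S`.
  minimal i k l := by
    refine Ideal.mem_map_of_mem _ ?_
    have h := F.minimal i k l
    rw [← T.lifts, Matrix.map_apply, ← Ideal.mem_comap,
      Ideal.comap_map_of_surjective _ Ideal.Quotient.mk_surjective, ← RingHom.ker_eq_comap_bot,
      Ideal.mk_ker, sup_eq_left.2 hf] at h
    exact h
  regular := hreg

theorem map_toCISystem_D (T : CIOperators f F) (i : ℕ) :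
    ((T.δ' i).map (Ideal.Quotient.mk (seqIdeal (dropLast f)))).map
      (Ideal.Quotient.factor (seqIdeal_dropLast_le f)) = F.δ i := by
  rw [map_factor_map_mk, T.lifts]

theorem factorPi_toCISystem_D (T : CIOperators f F) (i : ℕ)
    (x : Fin (F.rank (i + 1)) → S ⧸ seqIdeal (dropLast f)) :
    factorPi f _ (((T.δ' i).map (Ideal.Quotient.mk (seqIdeal (dropLast f)))).mulVecLin x) =
      (F.δ i).mulVecLin (factorPi f _ x) := by
  rw [factorPi_mulVecLin, T.map_toCISystem_D]

/-- The module resolved by `F`, as a cokernel over `S ⧸ (f₁, …, f_{c-1})`. -/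
theorem exists_resolved_equiv (T : CIOperators f F)
    (hr : ∀ x, f (Fin.last c) • x ∈ LinearMap.range
      ((T.δ' 0).map (Ideal.Quotient.mk (seqIdeal (dropLast f)))).mulVecLin) :
    Nonempty (F.resolved ≃ₗ[S] (Fin (F.rank 0) → S ⧸ seqIdeal (dropLast f)) ⧸
      LinearMap.range ((T.δ' 0).map (Ideal.Quotient.mk (seqIdeal (dropLast f)))).mulVecLin) := by
  let Ψ : (Fin (F.rank 0) → S ⧸ seqIdeal (dropLast f)) →ₗ[S] F.resolved :=
    (LinearMap.range (F.δ 0).mulVecLin).mkQ.restrictScalars S ∘ₗ factorPi f _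
  have hΨ : Function.Surjective Ψ :=
    (Submodule.mkQ_surjective (LinearMap.range (F.δ 0).mulVecLin)).comp (factorPi_surjective f _)
  have hker : (LinearMap.range ((T.δ' 0).map
      (Ideal.Quotient.mk (seqIdeal (dropLast f)))).mulVecLin).restrictScalars S =
      LinearMap.ker Ψ := by
    ext x
    have h1 : x ∈ LinearMap.ker Ψ ↔ factorPi f _ x ∈ LinearMap.range (F.δ 0).mulVecLin :=
      Submodule.Quotient.mk_eq_zero _
    rw [h1, Submodule.restrictScalars_mem]
    constructor
    · rintro ⟨y, rfl⟩
      exact ⟨factorPi f _ y, by rw [factorPi_mulVecLin, T.map_toCISystem_D]⟩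
    · rintro ⟨w, hw⟩
      obtain ⟨w, rfl⟩ := factorPi_surjective f _ w
      rw [← T.map_toCISystem_D, ← factorPi_mulVecLin, eq_comm, ← sub_eq_zero, ← map_sub] at hw
      obtain ⟨z, hz⟩ := exists_eq_smul_of_factorPi_eq_zero f hw
      rw [sub_eq_iff_eq_add'.1 hz]
      -- The two cokernels agree because the range of the lifting already contains the multiples of
      -- the last member.
      exact add_mem ⟨w, rfl⟩ (hr z)
  exact ⟨((Ψ.quotKerEquivOfSurjective hΨ).symm.trans (Submodule.quotEquivOfEq _ _ hker.symm)).trans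
    (Submodule.Quotient.restrictScalarsEquiv S _)⟩

end CIOperators

/-! ### Induction on the length of the sequence, and the theorem -/

namespace MinimalFreeResolution

variable {S : Type u} [CommRing S] [IsLocalRing S] {I : Ideal S}

/-- The minimal resolution of the second syzygy. -/
def shift (F : MinimalFreeResolution I) : MinimalFreeResolution I where
  rank i := F.rank (i + 2)
  δ i := F.δ (i + 2)
  exact i := F.exact (i + 2)
  minimal i := F.minimal (i + 2)

/-- The second syzygy is resolved by the shifted resolution. -/
noncomputable def kerFirstEquiv (F : MinimalFreeResolution I) :
    F.kerFirst ≃ₗ[S ⧸ I] F.shift.resolved :=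
  (LinearEquiv.ofEq _ _ (F.ker_eq 0)).trans <|
    ((F.δ 1).mulVecLin.quotKerEquivRange.symm).trans
      (Submodule.quotEquivOfEq _ _ (F.ker_eq 1))

/-- If F₀ = 0, then F₂ → F₁ is surjective and minimal, so F₁ = 0 by Nakayama. -/
theorem subsingleton_kerFirst [IsNoetherianRing S] (hI : I ≤ IsLocalRing.maximalIdeal S)
    (F : MinimalFreeResolution I) (h : F.rank 0 = 0) : Subsingleton F.kerFirst := by
  have h0 : IsEmpty (Fin (F.rank 0)) := by rw [h]; infer_instance
  have h1 : LinearMap.range (F.δ 1).mulVecLin = ⊤ := by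
    rw [← F.ker_eq 0, eq_top_iff]
    exact fun x _ ↦ Subsingleton.elim _ _
  have h2 : F.rank 1 = 0 := eq_zero_of_subsingleton_coker hI (F.minimal 1)
    (Submodule.Quotient.subsingleton_iff.2 h1)
  have h3 : IsEmpty (Fin (F.rank 1)) := by rw [h2]; infer_instance
  infer_instance

end MinimalFreeResolution

/-- The recursion common to pre-stable and stable syzygies: if `st` holds, then the resolved modules
have to be maximal Cohen-Macaulay. -/
def IsSyzygyOfType {S : Type u} [CommRing S] [IsLocalRing S] (st : Prop) :
    (c : ℕ) → (f : Fin c → S) → (M : Type u) → [AddCommGroup M] → [Module (S ⧸ seqIdeal f) M] → Prop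
  | 0, _, M, _, _ => Subsingleton M
  | c + 1, f, M, _, _ =>
    ∃ F : MinimalFreeResolution (seqIdeal f),
      HasSurjectiveLastCIOperator f F ∧ Nonempty (M ≃ₗ[S ⧸ seqIdeal f] F.kerFirst) ∧
      (st → IsMaximalCohenMacaulay (S ⧸ seqIdeal f) F.resolved) ∧
      ∀ δ₁' : Matrix (Fin (F.rank 0)) (Fin (F.rank 1)) (S ⧸ seqIdeal (dropLast f)),
        IsLiftOfFirst f F δ₁' →
          IsSyzygyOfType st c (dropLast f) (LinearMap.ker δ₁'.mulVecLin)

theorem isReduction_of_subsingleton {S : Type*} [CommRing S] {I : Ideal S} {A F : Type*} [AddCommGroup A] [Module S A]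
    [AddCommGroup F] [Module S F] [Subsingleton A] [Subsingleton F] (ρ : A →ₗ[S] F) :
    IsReduction I ρ where
  surjective _ := ⟨0, Subsingleton.elim _ _⟩
  ker_eq := Subsingleton.elim _ _

theorem IsReduction.of_eq {S : Type*} [CommRing S] {I I' : Ideal S} (h : I = I') {A F : Type*}
    [AddCommGroup A] [Module S A] [AddCommGroup F] [Module S F] {ρ : A →ₗ[S] F}
    (hρ : IsReduction I ρ) : IsReduction I' ρ :=
  h ▸ hρ

theorem IsMCMOver.of_eq {S : Type u} [CommRing S] [IsLocalRing S] {I I' : Ideal S} (h : I = I')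
    {N : Type u} [AddCommGroup N] [Module S N] (hN : IsMCMOver I N) : IsMCMOver I' N :=
  h ▸ hN

theorem isMCMOver_self_of_eq {S : Type u} [CommRing S] [IsLocalRing S] {I I' : Ideal S}
    (h : I = I') (hI : IsMCMOver I (S ⧸ I)) : IsMCMOver I' (S ⧸ I') := by
  subst h
  exact hI

section

variable {S : Type u} [CommRing S] [IsLocalRing S]

theorem IsPreStableSyzygy.isSyzygyOfType {c : ℕ} {f : Fin c → S} {M : Type u} [AddCommGroup M]
    [Module (S ⧸ seqIdeal f) M] (h : IsPreStableSyzygy c f M) : IsSyzygyOfType False c f M := by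
  induction c generalizing M with
  | zero => exact h
  | succ c ih =>
    obtain ⟨F, -, h1, h2, h3⟩ := h
    exact ⟨F, h1, h2, False.elim, fun δ hδ ↦ ih (h3 δ hδ)⟩

theorem IsStableSyzygy.isSyzygyOfType {c : ℕ} {f : Fin c → S} {M : Type u} [AddCommGroup M]
    [Module (S ⧸ seqIdeal f) M] (h : IsStableSyzygy c f M) : IsSyzygyOfType True c f M := by
  induction c generalizing M with
  | zero => exact h
  | succ c ih =>
    obtain ⟨F, -, h1, h2, h3, h4⟩ := h
    exact ⟨F, h1, h2, fun _ ↦ h3, fun δ hδ ↦ ih (h4 δ hδ)⟩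

/-- The zero filtered module. -/
def FilteredFreeModule.zero (S : Type u) [CommRing S] : FilteredFreeModule S 0 where
  carrier := PUnit
  fil _ := ⊥
  fil_zero := rfl
  fil_last := Subsingleton.elim _ _
  free _ := Module.Free.of_subsingleton _ _
  summand p := p.elim0

/-- The zero higher matrix factorization. -/
def AmbientHMF.zero (f : Fin 0 → S) : AmbientHMF f where
  A₀ := FilteredFreeModule.zero S
  A₁ := FilteredFreeModule.zero S
  d := 0
  d_fil _ _ _ := by simp
  h p := p.elim0
  h_fil p := p.elim0
  d_h p := p.elim0
  h_d p := p.elim0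

/-- The resolution of the zero module. -/
def MinimalFreeResolution.zero (I : Ideal S) : MinimalFreeResolution I where
  rank _ := 0
  δ _ := 0
  exact _ _ := ⟨fun _ ↦ ⟨0, Subsingleton.elim _ _⟩, fun _ ↦ Subsingleton.elim _ _⟩
  minimal _ k := k.elim0

theorem AmbientHMF.zero_reducesTo (f : Fin 0 → S) :
    (AmbientHMF.zero f).ReducesTo (MinimalFreeResolution.zero (seqIdeal f)) := by
  have h0 : Subsingleton (AmbientHMF.zero f).A₀.carrier := inferInstanceAs (Subsingleton PUnit)
  have h1 : Subsingleton (AmbientHMF.zero f).A₁.carrier := inferInstanceAs (Subsingleton PUnit)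
  have h2 : ∀ i, Subsingleton (Fin ((MinimalFreeResolution.zero (seqIdeal f)).rank i) →
      S ⧸ seqIdeal f) := fun _ ↦ inferInstanceAs (Subsingleton (Fin 0 → S ⧸ seqIdeal f))
  exact ⟨0, 0, 0, isReduction_of_subsingleton _, isReduction_of_subsingleton _,
    isReduction_of_subsingleton _, fun _ ↦ Subsingleton.elim _ _, fun _ ↦ Subsingleton.elim _ _⟩

/-- A syzygy is the module of a higher matrix factorization that reduces to its minimal resolution.
If the resolved modules are maximal Cohen-Macaulay, then moreover `S ⧸ (f₁, …, f_c)` is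
Cohen-Macaulay unless the syzygy vanishes. -/
theorem exists_ambientHMF [IsNoetherianRing S] (st : Prop) {c : ℕ} {f : Fin c → S}
    (hf : RingTheory.Sequence.IsRegular S (List.ofFn f)) {M : Type u} [AddCommGroup M]
    [Module (S ⧸ seqIdeal f) M] (hM : IsSyzygyOfType st c f M) :
    (∃ Y : AmbientHMF f, (∀ p, Y.PreStableAt p) ∧ (st → ∀ p, Y.StableAt p) ∧
      ∃ F : MinimalFreeResolution (seqIdeal f),
        Nonempty (M ≃ₗ[S ⧸ seqIdeal f] F.resolved) ∧ Y.ReducesTo F) ∧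
    (st → Subsingleton M ∨ IsMCMOver (seqIdeal f) (S ⧸ seqIdeal f)) := by
  induction c generalizing M with
  | zero =>
    have hM' : Subsingleton M := hM
    refine ⟨⟨AmbientHMF.zero f, fun p ↦ p.elim0, fun _ p ↦ p.elim0,
      MinimalFreeResolution.zero _, ?_, AmbientHMF.zero_reducesTo f⟩, fun _ ↦ .inl hM'⟩
    have h : Subsingleton (MinimalFreeResolution.zero (seqIdeal f)).resolved :=
      have : Subsingleton (Fin ((MinimalFreeResolution.zero (seqIdeal f)).rank 0) →
        S ⧸ seqIdeal f) := inferInstanceAs (Subsingleton (Fin 0 → S ⧸ seqIdeal f))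
      (Submodule.mkQ_surjective _).subsingleton
    exact ⟨0⟩
  | succ c ih =>
    obtain ⟨F, ⟨T, hT⟩, ⟨e⟩, hL, hlift⟩ := hM
    have hm := seqIdeal_le_maximalIdeal hf
    have hJ : seqIdeal (dropLast f) ≤ IsLocalRing.maximalIdeal S :=
      (seqIdeal_dropLast_le f).trans hm
    have hlast : f (Fin.last c) ∈ IsLocalRing.maximalIdeal S := hm (Ideal.subset_span ⟨_, rfl⟩)
    have hreg := isSMulRegular_last hf
    let C := T.toCISystem hm hreg hT
    -- The hypothesis covers every lifting of the first differential, in particular the one that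
    -- belongs to the surjective CI operator.
    obtain ⟨⟨Y, hY, hY', F', ⟨e'⟩, hYF⟩, hdich⟩ :=
      ih (isRegular_dropLast hf) (hlift (C.D 0) (T.map_toCISystem_D 0))
    obtain ⟨Z, ⟨ρ₀, ρ₁, ρ₂, h₀, h₁, h₂, hd, hh⟩, hZ, hZ'⟩ := exists_extension C Y F' hYF e'.symm
    have hCM : st → IsMCMOver (seqIdeal (dropLast f)) (LinearMap.range (C.D 0).mulVecLin) ∧
        (F.rank 0 = 0 ∨ IsMCMOver (seqIdeal f) (S ⧸ seqIdeal f)) := by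
      intro hst
      obtain ⟨E⟩ := T.exists_resolved_equiv C.smul_mem_range
      have hL' := (isMaximalCohenMacaulay_quotient_iff.1 (hL hst)).2.congr E
      have hI := seqIdeal_eq_sup f
      obtain ⟨h1, h2⟩ := isMCMOver_range hJ hlast hreg (C.minimal 0) C.smul_mem_range
        (hL'.of_eq hI) (hdich hst)
      exact ⟨h1, h2.imp_right (isMCMOver_self_of_eq hI.symm)⟩
    -- The reductions of `Z` are modulo the earlier members; composing with reduction modulo the
    -- last one lands in the shifted resolution, which resolves `M`.
    refine ⟨⟨Z, hZ hY, fun hst ↦ hZ' (hCM hst).1 (hY' hst), F.shift,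
      ⟨e.trans F.kerFirstEquiv⟩, factorPi f _ ∘ₗ ρ₀, factorPi f _ ∘ₗ ρ₁, factorPi f _ ∘ₗ ρ₂,
      ((isReduction_factorPi f _).comp h₀).of_eq (seqIdeal_eq_sup f).symm,
      ((isReduction_factorPi f _).comp h₁).of_eq (seqIdeal_eq_sup f).symm,
      ((isReduction_factorPi f _).comp h₂).of_eq (seqIdeal_eq_sup f).symm,
      fun x ↦ (congrArg (factorPi f _) (hd x)).trans (T.factorPi_toCISystem_D 2 (ρ₁ x)),
      fun x ↦ (congrArg (factorPi f _) (hh x)).trans (T.factorPi_toCISystem_D 3 (ρ₂ x))⟩,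
      fun hst ↦ (hCM hst).2.imp_left fun h ↦ ?_⟩
    have := F.subsingleton_kerFirst hm h
    exact e.toEquiv.subsingleton

end

theorem exists_hmf_of_isSyzygyOfType {S : Type u} [CommRing S] [IsNoetherianRing S]
    [IsLocalRing S] (st : Prop) {c : ℕ} {f : Fin c → S}
    (hf : RingTheory.Sequence.IsRegular S (List.ofFn f)) {M : Type u} [AddCommGroup M]
    [Module (S ⧸ seqIdeal f) M] (hM : IsSyzygyOfType st c f M) :
    ∃ X : HigherMatrixFactorization f,
      X.IsMinimal ∧ X.IsPreStable ∧
      Nonempty (M ≃ₗ[S ⧸ seqIdeal f] X.hmfModule) ∧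
      (∃ F : MinimalFreeResolution (seqIdeal f),
        Nonempty (M ≃ₗ[S ⧸ seqIdeal f] F.resolved) ∧ X.LiftsFirstTwo F) ∧
      (st → X.IsStable) := by
  obtain ⟨⟨Y, hY, hY', F, ⟨e⟩, hYF⟩, -⟩ := exists_ambientHMF st hf hM
  have hX := AmbientHMF.liftsFirstTwo_toHMF hYF
  obtain ⟨e'⟩ := AmbientHMF.resolved_equiv_hmfModule hX
  exact ⟨Y.toHMF, AmbientHMF.isMinimal_toHMF (seqIdeal_le_maximalIdeal hf) hYF,
    AmbientHMF.isPreStable_toHMF hY, ⟨e.trans e'⟩, ⟨F, ⟨e⟩, hX⟩,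
    fun hst ↦ AmbientHMF.isStable_toHMF (hY' hst)⟩

theorem mainTheorem5 {S : Type u} [CommRing S] [IsNoetherianRing S] [IsLocalRing S]
    (c : ℕ) (f : Fin c → S) (hf : RingTheory.Sequence.IsRegular S (List.ofFn f))
    (M : Type u) [AddCommGroup M] [Module (S ⧸ seqIdeal f) M]
    (hM : IsPreStableSyzygy c f M) :
    ∃ X : HigherMatrixFactorization f,
      X.IsMinimal ∧ X.IsPreStable ∧
      Nonempty (M ≃ₗ[S ⧸ seqIdeal f] X.hmfModule) ∧
      (∃ F : MinimalFreeResolution (seqIdeal f),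
        Nonempty (M ≃ₗ[S ⧸ seqIdeal f] F.resolved) ∧ X.LiftsFirstTwo F) ∧
      (IsStableSyzygy c f M → X.IsStable) := by
  -- One factorization has to serve both conclusions, so the kind of recursion used is decided by
  -- whether `M` is stable.
  by_cases h : IsStableSyzygy c f M
  · obtain ⟨X, h1, h2, h3, h4, h5⟩ := exists_hmf_of_isSyzygyOfType True hf h.isSyzygyOfType
    exact ⟨X, h1, h2, h3, h4, fun _ ↦ h5 trivial⟩
  · obtain ⟨X, h1, h2, h3, h4, -⟩ := exists_hmf_of_isSyzygyOfType False hf hM.isSyzygyOfType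
    exact ⟨X, h1, h2, h3, h4, fun h' ↦ absurd h' h⟩
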